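/- Fix a dimension $d\ge 1$. For $v\in\mathbb{Z}^d$ let $\|v\|_1=|v_1|+\dots+|v_d|$; vertices $v,w$ are adjacent if $\|v-w\|_1=1$. Let $\mathbb{Z}^d_{\mathrm{even}}=\{v:\|v\|_1\text{ even}\}$ and $\Lambda(L)=\{v\in\mathbb{Z}^d:\|v\|_1\le L\}$. For $\Lambda\subset\mathbb{Z}^d$ let $\partial_\circ\Lambda$ be the set of vertices outside $\Lambda$ that are adjacent to a vertex of $\Lambda$, and let $\Lambda^+=\Lambda\cup\partial_\circ\Lambda$. A homomorphism height function on $S\subset\mathbb{Z}^d$ is a function $f:S\to\mathbb{Z}$ with $|f(u)-f(v)|\le\|u-v\|_1$ and $f(v)\equiv\|v\|_1\pmod 2$ for all $u,v\in S$. For a non-empty finite $\Lambda$ and a homomorphism height function $\tau$ on $\partial_\circ\Lambda$, let $\mu^{\Lambda,\tau}$ be the uniform probability measure on the homomorphism height functions $f$ on $\Lambda^+$ with $f=\tau$ on $\partial_\circ\Lambda$; write $\mu^{\Lambda,0}$ when $\tau\equiv 0$. A Gibbs measure is a probability measure $\mu$ on homomorphism height functions on $\mathbb{Z}^d$ such that,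 for $f$ sampled from $\mu$ and every non-empty finite $\Lambda\subset\mathbb{Z}^d$, the conditional distribution of $f|_{\Lambda^+}$ given $f|_{\Lambda^c}$ is almost surely $\mu^{\Lambda,\tau}$ with $\tau=f|_{\partial_\circ\Lambda}$. It is $\mathbb{Z}^d_{\mathrm{even}}$-translation-invariant if it is invariant in distribution under translations by all vectors of $\mathbb{Z}^d_{\mathrm{even}}$. Then exactly one of the following two alternatives holds. (i) For odd integers $L\ge 1$ let $f_L$ be sampled from $\mu^{\Lambda(L),0}$. The random variables $f_L(\mathbf 0)$, $L\ge 1$ odd, are not tight, that is, $$\lim_{M\to\infty}\ \sup_{L\ge 1\text{ odd}}\ \mathbb{P}\bigl(|f_L(\mathbf 0)|>M\bigr)>0.$$ (ii) The sequence $(\mu^{\Lambda(L),0})$, $L\ge 1$ odd, converges in distribution to a $\mathbb{Z}^d_{\mathrm{even}}$-translation-invariant Gibbs measure $\mu$; that is, for every finite $S\subset\mathbb{Z}^d$, the marginal distribution of $\mu^{\Lambda(L),0}$ on $S$ (defined for all large $L$) converges in distribution to the marginal of $\mu$ on $S$ as $L\to\infty$ along the odd integers. -/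

import Mathlib

open MeasureTheory ProbabilityTheory Filter Topology
open scoped ENNReal BoundedContinuousFunction

noncomputable section

namespace HomHeight

/-- The vertices of the lattice `ℤ^d`. -/
abbrev Vertex (d : ℕ) : Type := Fin d → ℤ

/-- The `ℓ¹` norm on `ℤ^d`. -/
def l1norm {d : ℕ} (v : Vertex d) : ℕ := ∑ i, (v i).natAbs

/-- Adjacency in `ℤ^d`. -/
def Adj {d : ℕ} (v w : Vertex d) : Prop := l1norm (v - w) = 1

/-- The even sublattice of `ℤ^d`. -/
def evenLattice (d : ℕ) : Set (Vertex d) := {v | Even (l1norm v)}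

/-- The graph ball `Λ(L)` around the origin. -/
def ball (d L : ℕ) : Set (Vertex d) := {v | l1norm v ≤ L}

/-- The external vertex boundary of a set of vertices. -/
def boundary {d : ℕ} (Λ : Set (Vertex d)) : Set (Vertex d) :=
  {v | v ∉ Λ ∧ ∃ w ∈ Λ, Adj w v}

/-- The 1-extension `Λ⁺` of a set of vertices. -/
def extension {d : ℕ} (Λ : Set (Vertex d)) : Set (Vertex d) := Λ ∪ boundary Λ

theorem boundary_subset_extension {d : ℕ} (Λ : Set (Vertex d)) :
    boundary Λ ⊆ extension Λ := Set.subset_union_right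

theorem zero_mem_extension_ball (d L : ℕ) : (0 : Vertex d) ∈ extension (ball d L) :=
  Or.inl (by simp [ball, l1norm])

/-- The restriction of a function on `ℤ^d` to a subset. -/
def restr {d : ℕ} (S : Set (Vertex d)) (f : Vertex d → ℤ) : S → ℤ := fun v => f v.1

/-- The restriction of a function on a subset of `ℤ^d` to a smaller subset. -/
def restrSub {d : ℕ} {S T : Set (Vertex d)} (h : S ⊆ T) (f : T → ℤ) : S → ℤ :=
  fun v => f ⟨v.1, h v.2⟩

/-- Homomorphism height functions on a subset `S` of `ℤ^d`: the Lipschitz condition and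
the parity condition. -/
def IsHeight {d : ℕ} {S : Set (Vertex d)} (f : S → ℤ) : Prop :=
  (∀ u v : S, |f u - f v| ≤ (l1norm (u.1 - v.1) : ℤ)) ∧
    ∀ v : S, f v ≡ (l1norm v.1 : ℤ) [ZMOD 2]

/-- The finite-volume Gibbs measure `μ^{Λ,τ}`: the uniform measure on the homomorphism height
functions on `Λ⁺` that agree with `τ` on the external boundary of `Λ`. -/
def finiteVolume {d : ℕ} (Λ : Set (Vertex d)) (τ : boundary Λ → ℤ) :
    Measure (extension Λ → ℤ) :=
  uniformOn {f | IsHeight f ∧ restrSub (boundary_subset_extension Λ) f = τ}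

/-- Infinite-volume Gibbs measures: probability measures carried by the homomorphism height
functions on `ℤ^d` such that, for each non-empty finite `Λ`, the conditional distribution of
`f_{Λ⁺}` given `f_{Λᶜ}` is almost surely `μ^{Λ,τ}` with `τ` the restriction of `f` to the
external boundary of `Λ`. -/
def IsGibbs {d : ℕ} (μ : Measure (Vertex d → ℤ)) : Prop :=
  IsProbabilityMeasure μ ∧
  (∀ᵐ f ∂μ, IsHeight (restr Set.univ f)) ∧
  ∀ Λ : Set (Vertex d), Λ.Nonempty → Λ.Finite →
    ∀ A : Set (extension Λ → ℤ), MeasurableSet A →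
      μ⟦restr (extension Λ) ⁻¹' A |
          MeasurableSpace.comap (restr Λᶜ) MeasurableSpace.pi⟧
        =ᵐ[μ] fun f => (finiteVolume Λ (restr (boundary Λ) f)).real A

/-- Invariance in distribution under all translations by vectors in `𝓛`. -/
def IsTranslationInvariant {d : ℕ} (𝓛 : Set (Vertex d)) (μ : Measure (Vertex d → ℤ)) : Prop :=
  ∀ u ∈ 𝓛, μ.map (fun f v => f (v + u)) = μ

/-- Convergence in distribution (thermodynamic limit) of a sequence of finite-volume Gibbs
measures to a measure `μ` on functions on `ℤ^d`: for each finite set `S`, the marginal on `S`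
is defined for all large `n` and converges weakly to the marginal of `μ` on `S`. -/
def ConvergesInDistribution {d : ℕ} (Λ : ℕ → Set (Vertex d)) (τ : ∀ n, boundary (Λ n) → ℤ)
    (μ : Measure (Vertex d → ℤ)) : Prop :=
  ∀ S : Set (Vertex d), S.Finite → ∀ φ : (S → ℤ) →ᵇ ℝ, ∀ ε : ℝ, 0 < ε →
    ∀ᶠ n in atTop, ∃ h : S ⊆ extension (Λ n),
      |(∫ g, φ g ∂((finiteVolume (Λ n) (τ n)).map (restrSub h)))
        - ∫ g, φ g ∂(μ.map (restr S))| < ε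

/-- `sup_L P(|f_L(0)| > M)`, where `f_L` is sampled from `μ^{Λ(L),0}` and `L = 2n + 1` runs over
the odd positive integers. -/
def supTail (d M : ℕ) : ℝ≥0∞ :=
  ⨆ n : ℕ, finiteVolume (ball d (2 * n + 1)) 0
    {f | (M : ℤ) < |f ⟨0, zero_mem_extension_ball d (2 * n + 1)⟩|}

/-- The heights at the origin under `μ^{Λ(L),0}`, `L` odd, are not tight:
`lim_{M → ∞} sup_L P(|f_L(0)| > M)` is positive. -/
def NotTightAtZero (d : ℕ) : Prop :=
  ∃ c : ℝ≥0∞, 0 < c ∧ Tendsto (supTail d) atTop (𝓝 c)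

/-- The measures `μ^{Λ(L),0}`, `L = 2n + 1` odd, converge in distribution to a Gibbs measure
that is invariant under translations by the even sublattice. -/
def ConvergesToInvariantGibbs (d : ℕ) : Prop :=
  ∃ μ : Measure (Vertex d → ℤ), IsGibbs μ ∧ IsTranslationInvariant (evenLattice d) μ ∧
    ConvergesInDistribution (fun n => ball d (2 * n + 1)) (fun _ => 0) μ

end HomHeight

end

/-!
The dichotomy rests on a correlation inequality for absolute values. A height function with zero
boundary values on a domain whose external boundary is even extends to the lattice by the parity
function; `configs Λ` is the set of these extensions, and the finite-volume measure is the image of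
the uniform measure on it. Given the absolute value `h = |f|`, the function `f` is described by its
signs at the odd vertices, where it never vanishes, and the only constraint is that all neighbours
of an even vertex with `h > 0` carry the same sign. The admissible signs therefore form a group
`signGroup Λ h`, decreasing in `h`. Elementary group theory (`card_signGroup_mul_le`) gives the
Holley condition for the number of admissible signs in two nested domains, and the sum of a product
of signs over the group is the size of the group or zero, according to whether the product is
trivial on it, which is an increasing condition in `h`. The four functions theorem then shows
(`average_mono`) that the average of `F |f|` times a product of signs of `f` is increasing in the
domain, for every nonnegative increasing `F`.

Indicators of cylinder events are combinations of such functions, so their probabilities converge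
along balls, with the same limit along balls translated by an even vector, because translated balls
are sandwiched between balls (`tendsto_average_pinned`). If the heights at the origin are tight, the
Lipschitz property makes the measures tight on the whole lattice, and Prokhorov's theorem turns
convergence of cylinder probabilities into weak convergence to a probability measure
(`exists_tendsto_ballLaw`). The limit is invariant under even translations, and the domain Markov
property passes to the limit because it only involves finitely many vertices at a time
(`isGibbs_of_tendsto`). Conversely, convergence in distribution forces tightness at the origin
(`tendsto_supTail_of_convergesInDistribution`), so the alternatives exclude each other.
-/

namespace HomHeight

variable {d : ℕ}

/-! ### Geometry of the lattice -/

theorem l1norm_sub_le (u v w : Vertex d) :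
    l1norm (u - w) ≤ l1norm (u - v) + l1norm (v - w) := by
  simp only [l1norm, ← Finset.sum_add_distrib]
  refine Finset.sum_le_sum fun i _ => ?_
  simp only [Pi.sub_apply]
  omega

theorem l1norm_sub_comm (u v : Vertex d) : l1norm (u - v) = l1norm (v - u) := by
  simp only [l1norm, Pi.sub_apply]
  exact Finset.sum_congr rfl fun i _ => by omega

theorem l1norm_eq_zero {v : Vertex d} : l1norm v = 0 ↔ v = 0 := by
  simp [l1norm, funext_iff]

theorem l1norm_neg (u : Vertex d) : l1norm (-u) = l1norm u := by simp [l1norm]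

theorem l1norm_add_le (u v : Vertex d) : l1norm (u + v) ≤ l1norm u + l1norm v := by
  simpa [l1norm_neg] using l1norm_sub_le u 0 (-v)

theorem l1norm_modEq_sum (v : Vertex d) : (l1norm v : ℤ) ≡ ∑ i, v i [ZMOD 2] := by
  simp only [l1norm, Nat.cast_sum]
  refine Int.ModEq.sum fun i _ => ?_
  simp only [Int.ModEq]
  omega

theorem l1norm_add_modEq (u v : Vertex d) :
    (l1norm (u + v) : ℤ) ≡ l1norm u + l1norm v [ZMOD 2] := by
  refine (l1norm_modEq_sum _).trans ?_
  simp only [Pi.add_apply, Finset.sum_add_distrib]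
  exact ((l1norm_modEq_sum u).add (l1norm_modEq_sum v)).symm

theorem even_l1norm_add_iff (u v : Vertex d) :
    Even (l1norm (u + v)) ↔ (Even (l1norm u) ↔ Even (l1norm v)) := by
  have h := l1norm_add_modEq u v
  rw [← Nat.even_add]
  simp only [Nat.even_iff, Int.ModEq] at *
  omega

theorem Adj.symm {u v : Vertex d} (h : Adj u v) : Adj v u := by
  rw [Adj, l1norm_sub_comm]; exact h

theorem Adj.even_iff {u v : Vertex d} (h : Adj u v) :
    Even (l1norm u) ↔ ¬ Even (l1norm v) := by
  have h1 := even_l1norm_add_iff (u - v) v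
  rw [Adj] at h
  rw [sub_add_cancel, h] at h1
  rw [h1]
  simp

/-- Distinct vertices have a neighbour step that brings the first closer to the second. -/
theorem exists_adj_between {u v : Vertex d} (h : u ≠ v) :
    ∃ w, Adj u w ∧ l1norm (u - v) = 1 + l1norm (w - v) := by
  obtain ⟨i, hi⟩ := Function.ne_iff.mp h
  have key : ∀ s : ℤ, s.natAbs = 1 → (u i - v i).natAbs = 1 + (u i + s - v i).natAbs →
      ∃ w, Adj u w ∧ l1norm (u - v) = 1 + l1norm (w - v) := by
    intro s hs hs'
    refine ⟨u + Pi.single i s, ?_, ?_⟩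
    · simp only [Adj, l1norm]
      rw [Finset.sum_eq_single i]
      · simp [hs]
      · intro j _ hj
        simp [hj]
      · simp
    · simp only [l1norm]
      rw [← Finset.add_sum_erase _ _ (Finset.mem_univ i),
        ← Finset.add_sum_erase Finset.univ
          (fun j => ((u + (Pi.single i s : Vertex d) - v) j).natAbs) (Finset.mem_univ i),
        ← add_assoc]
      congr 1
      · simpa using hs'
      · refine Finset.sum_congr rfl fun j hj => ?_
        simp [(Finset.mem_erase.mp hj).1]
  rcases lt_or_gt_of_ne hi with h' | h'
  · exact key 1 rfl (by omega)
  · exact key (-1) rfl (by omega)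

/-- A geodesic that leaves `Λ` crosses its external boundary. -/
theorem exists_boundary_between {Λ : Set (Vertex d)} {u v : Vertex d} (hu : u ∈ Λ) (hv : v ∉ Λ) :
    ∃ w ∈ boundary Λ, l1norm (u - w) + l1norm (w - v) ≤ l1norm (u - v) := by
  induction hn : l1norm (u - v) generalizing u with
  | zero =>
    rw [l1norm_eq_zero, sub_eq_zero] at hn
    exact absurd (hn ▸ hu) hv
  | succ n ih =>
    have hne : u ≠ v := fun h => hv (h ▸ hu)
    obtain ⟨w, hw, hw'⟩ := exists_adj_between hne
    by_cases hwΛ : w ∈ Λ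
    · obtain ⟨x, hx, hx'⟩ := ih hwΛ (by omega)
      have := l1norm_sub_le u w x
      rw [Adj] at hw
      exact ⟨x, hx, by omega⟩
    · refine ⟨w, ⟨hwΛ, u, hu, hw⟩, ?_⟩
      rw [Adj] at hw
      omega

/-! ### Height functions on the whole lattice -/

/-- Homomorphism height functions on all of `ℤ^d`, as functions on the lattice itself rather than
on the subtype of the universal set. -/
structure IsGlobalHeight (f : Vertex d → ℤ) : Prop where
  lipschitz : ∀ u v, |f u - f v| ≤ (l1norm (u - v) : ℤ)
  modEq : ∀ v, f v ≡ (l1norm v : ℤ) [ZMOD 2]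

theorem isHeight_restr_univ_iff {f : Vertex d → ℤ} :
    IsHeight (restr Set.univ f) ↔ IsGlobalHeight f :=
  ⟨fun h => ⟨fun u v => h.1 ⟨u, trivial⟩ ⟨v, trivial⟩, fun v => h.2 ⟨v, trivial⟩⟩,
    fun h => ⟨fun u v => h.1 u.1 v.1, fun v => h.2 v.1⟩⟩

theorem IsGlobalHeight.isHeight_restr {f : Vertex d → ℤ} (h : IsGlobalHeight f)
    (S : Set (Vertex d)) : IsHeight (restr S f) :=
  ⟨fun u v => h.1 u.1 v.1, fun v => h.2 v.1⟩

theorem IsGlobalHeight.of_adj {f : Vertex d → ℤ} (hm : ∀ v, f v ≡ (l1norm v : ℤ) [ZMOD 2])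
    (ha : ∀ u v, Adj u v → |f u - f v| ≤ 1) : IsGlobalHeight f := by
  refine ⟨fun u v => ?_, hm⟩
  induction hn : l1norm (u - v) generalizing u with
  | zero =>
    rw [l1norm_eq_zero, sub_eq_zero] at hn
    simp [hn]
  | succ n ih =>
    have hne : u ≠ v := by
      rintro rfl
      simp [l1norm] at hn
    obtain ⟨w, hw, hw'⟩ := exists_adj_between hne
    have h1 := ha u w hw
    have h2 := ih w (by omega)
    have h3 := abs_sub_le (f u) (f w) (f v)
    push_cast
    linarith

theorem IsGlobalHeight.abs_sub_le_one {f : Vertex d → ℤ} (h : IsGlobalHeight f) {u v : Vertex d}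
    (huv : Adj u v) : |f u - f v| ≤ 1 := by
  have := h.lipschitz u v
  rw [Adj] at huv
  rwa [huv] at this

theorem IsGlobalHeight.abs_le_abs_add {f : Vertex d → ℤ} (h : IsGlobalHeight f) (u v : Vertex d) :
    |f u| ≤ |f v| + l1norm (u - v) := by
  have h1 := h.lipschitz u v
  have h2 := abs_sub_abs_le_abs_sub (f u) (f v)
  linarith

theorem IsGlobalHeight.even_iff {f : Vertex d → ℤ} (h : IsGlobalHeight f) (v : Vertex d) :
    Even (f v) ↔ Even (l1norm v) := by
  have := h.modEq v
  simp only [Int.ModEq, Int.even_iff, Nat.even_iff] at *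
  omega

theorem IsGlobalHeight.shift {f : Vertex d → ℤ} (h : IsGlobalHeight f) {u : Vertex d}
    (hu : u ∈ evenLattice d) : IsGlobalHeight fun v => f (v + u) := by
  refine ⟨fun v w => by simpa using h.lipschitz (v + u) (w + u), fun v => ?_⟩
  refine (h.modEq _).trans ((l1norm_add_modEq v u).trans ?_)
  have : Even (l1norm u) := hu
  simp only [Nat.even_iff, Int.ModEq] at *
  omega

/-- The height function with values `0` on even and `1` on odd vertices. -/
def parity (v : Vertex d) : ℤ := (l1norm v : ℤ) % 2

theorem parity_of_even {v : Vertex d} (hv : Even (l1norm v)) : parity v = 0 := by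
  rw [Nat.even_iff] at hv
  simp only [parity]
  omega

theorem parity_of_not_even {v : Vertex d} (hv : ¬ Even (l1norm v)) : parity v = 1 := by
  rw [Nat.even_iff] at hv
  simp only [parity]
  omega

theorem isGlobalHeight_parity : IsGlobalHeight (parity : Vertex d → ℤ) := by
  refine .of_adj (fun v => by simp [parity, Int.ModEq]) fun u v _ => ?_
  simp only [parity]
  rw [abs_le]
  omega

theorem parity_add {u : Vertex d} (hu : u ∈ evenLattice d) (v : Vertex d) :
    parity (v + u) = parity v := by
  have hu' : Even (l1norm u) := hu
  by_cases hv : Even (l1norm v)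
  · rw [parity_of_even hv, parity_of_even ((even_l1norm_add_iff v u).2 (by tauto))]
  · rw [parity_of_not_even hv, parity_of_not_even (by rw [even_l1norm_add_iff v u]; tauto)]

theorem IsGlobalHeight.parity_le_abs {f : Vertex d → ℤ} (h : IsGlobalHeight f) (v : Vertex d) :
    parity v ≤ |f v| := by
  have := h.modEq v
  simp only [parity, Int.ModEq] at *
  rw [le_abs]
  omega

theorem IsGlobalHeight.ne_zero {f : Vertex d → ℤ} (h : IsGlobalHeight f) {v : Vertex d}
    (hv : ¬ Even (l1norm v)) : f v ≠ 0 := by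
  intro h0
  rw [← h.even_iff, h0] at hv
  exact hv (by simp)

theorem IsGlobalHeight.abs {f : Vertex d → ℤ} (h : IsGlobalHeight f) : IsGlobalHeight |f| := by
  refine ⟨fun u v => (abs_abs_sub_abs_le (f u) (f v)).trans (h.lipschitz u v), fun v => ?_⟩
  have := h.modEq v
  rcases abs_choice (f v) with h' | h' <;> simp only [Pi.abs_apply, Int.ModEq, h'] at * <;> omega

theorem IsGlobalHeight.inf {f g : Vertex d → ℤ} (hf : IsGlobalHeight f) (hg : IsGlobalHeight g) :
    IsGlobalHeight (f ⊓ g) := by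
  constructor
  · intro u v
    have h1 := hf.lipschitz u v
    have h2 := hg.lipschitz u v
    simp only [Pi.inf_apply, abs_le] at *
    omega
  · intro v
    rcases min_choice (f v) (g v) with h | h
    · simpa [h] using hf.modEq v
    · simpa [h] using hg.modEq v

theorem IsGlobalHeight.sup {f g : Vertex d → ℤ} (hf : IsGlobalHeight f) (hg : IsGlobalHeight g) :
    IsGlobalHeight (f ⊔ g) := by
  constructor
  · intro u v
    have h1 := hf.lipschitz u v
    have h2 := hg.lipschitz u v
    simp only [Pi.sup_apply, abs_le] at *
    omega
  · intro v
    rcases max_choice (f v) (g v) with h | h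
    · simpa [h] using hf.modEq v
    · simpa [h] using hg.modEq v

/-! ### Gluing -/

open Classical in
/-- The function equal to `g` on `Λ` and to `f` off `Λ`. -/
noncomputable def glue (Λ : Set (Vertex d)) (g : extension Λ → ℤ) (f : Vertex d → ℤ) :
    Vertex d → ℤ :=
  fun v => if h : v ∈ Λ then g ⟨v, Or.inl h⟩ else f v

theorem glue_of_mem {Λ : Set (Vertex d)} (g : extension Λ → ℤ) (f : Vertex d → ℤ) {v : Vertex d}
    (h : v ∈ Λ) : glue Λ g f v = g ⟨v, Or.inl h⟩ := dif_pos h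

theorem glue_of_notMem {Λ : Set (Vertex d)} (g : extension Λ → ℤ) (f : Vertex d → ℤ) {v : Vertex d}
    (h : v ∉ Λ) : glue Λ g f v = f v := dif_neg h

theorem restr_glue {Λ : Set (Vertex d)} {g : extension Λ → ℤ} {f : Vertex d → ℤ}
    (h : restrSub (boundary_subset_extension Λ) g = restr (boundary Λ) f) :
    restr (extension Λ) (glue Λ g f) = g := by
  ext ⟨v, hv⟩
  by_cases hvΛ : v ∈ Λ
  · exact glue_of_mem g f hvΛ
  · have hb : v ∈ boundary Λ := hv.resolve_left hvΛ
    simp only [restr]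
    rw [glue_of_notMem g f hvΛ]
    exact (congrFun h ⟨v, hb⟩).symm

/-- A height function on `Λ⁺` and a height function on the lattice that agree on the external
boundary of `Λ` glue to a height function: the Lipschitz bound across the boundary holds because
geodesics leaving `Λ` pass through the boundary. -/
theorem isGlobalHeight_glue {Λ : Set (Vertex d)} {g : extension Λ → ℤ} {f : Vertex d → ℤ}
    (hg : IsHeight g) (hf : IsGlobalHeight f)
    (h : restrSub (boundary_subset_extension Λ) g = restr (boundary Λ) f) :
    IsGlobalHeight (glue Λ g f) := by
  have cross : ∀ u v, u ∈ Λ → v ∉ Λ → |glue Λ g f u - glue Λ g f v| ≤ (l1norm (u - v) : ℤ) := by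
    intro u v hu hv
    obtain ⟨w, hw, hle⟩ := exists_boundary_between hu hv
    have h1 := hg.1 ⟨u, Or.inl hu⟩ ⟨w, Or.inr hw⟩
    have h2 := hf.lipschitz w v
    have h3 : g ⟨w, Or.inr hw⟩ = f w := congrFun h ⟨w, hw⟩
    rw [glue_of_mem g f hu, glue_of_notMem g f hv]
    rw [h3] at h1
    have h4 := abs_sub_le (g ⟨u, Or.inl hu⟩) (f w) (f v)
    simp only at h1
    zify at hle
    linarith
  refine ⟨fun u v => ?_, fun v => ?_⟩
  · by_cases hu : u ∈ Λ <;> by_cases hv : v ∈ Λ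
    · rw [glue_of_mem g f hu, glue_of_mem g f hv]
      exact hg.1 ⟨u, _⟩ ⟨v, _⟩
    · exact cross u v hu hv
    · rw [abs_sub_comm, l1norm_sub_comm]
      exact cross v u hv hu
    · rw [glue_of_notMem g f hu, glue_of_notMem g f hv]
      exact hf.lipschitz u v
  · by_cases hv : v ∈ Λ
    · rw [glue_of_mem g f hv]
      exact hg.2 ⟨v, _⟩
    · rw [glue_of_notMem g f hv]
      exact hf.modEq v

/-! ### Finite-volume configurations as functions on the lattice -/

/-- The height functions with zero boundary values on `Λ`, extended to the lattice by the parity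
function. -/
def configs (Λ : Set (Vertex d)) : Set (Vertex d → ℤ) :=
  {f | IsGlobalHeight f ∧ ∀ v ∉ Λ, f v = parity v}

theorem configs_finite [NeZero d] {Λ : Set (Vertex d)} (hΛ : Λ.Finite) : (configs Λ).Finite := by
  obtain ⟨w, hw⟩ := hΛ.exists_notMem
  have : Finite Λ := hΛ
  have hinj : Set.InjOn (restr Λ) (configs Λ) := by
    intro f hf g hg hfg
    ext v
    by_cases hv : v ∈ Λ
    · exact congrFun hfg ⟨v, hv⟩
    · rw [hf.2 v hv, hg.2 v hv]
  refine Set.Finite.of_finite_image ?_ hinj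
  refine (Set.Finite.pi' (t := fun v : Λ => Set.Icc (-(1 + l1norm (v.1 - w) : ℤ))
    (1 + l1norm (v.1 - w))) fun v => Set.finite_Icc _ _).subset ?_
  rintro _ ⟨f, hf, rfl⟩ v
  have h1 := hf.1.abs_le_abs_add v w
  rw [hf.2 w hw] at h1
  have h2 : |(parity w : ℤ)| ≤ 1 := by
    simp only [parity]
    rw [abs_le]
    omega
  exact abs_le.1 (h1.trans (by simpa [restr] using h2))

theorem parity_mem_configs (Λ : Set (Vertex d)) : parity ∈ configs Λ :=
  ⟨isGlobalHeight_parity, fun _ _ => rfl⟩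

/-- A finite set of vertices whose external boundary consists of even vertices. -/
structure IsEvenDomain (Λ : Set (Vertex d)) : Prop where
  finite : Λ.Finite
  even : ∀ v ∈ boundary Λ, Even (l1norm v)

theorem IsEvenDomain.mem_of_adj {Λ : Set (Vertex d)} (hΛ : IsEvenDomain Λ) {x u : Vertex d}
    (hx : x ∈ Λ) (he : Even (l1norm x)) (h : Adj x u) : u ∈ Λ := by
  by_contra hu
  exact h.even_iff.1 he (hΛ.even u ⟨hu, x, hx, h⟩)

theorem ball_finite (L : ℕ) : (ball d L).Finite := by
  refine (Set.Finite.pi' (t := fun _ : Fin d => Set.Icc (-(L : ℤ)) L) fun _ =>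
    Set.finite_Icc _ _).subset fun v hv i => ?_
  have h1 : (v i).natAbs ≤ l1norm v :=
    Finset.single_le_sum (f := fun j => (v j).natAbs) (fun _ _ => Nat.zero_le _)
      (Finset.mem_univ i)
  have h2 : l1norm v ≤ L := hv
  simp only [Set.mem_Icc]
  omega

theorem l1norm_eq_of_mem_boundary_ball {L : ℕ} {v : Vertex d} (hv : v ∈ boundary (ball d L)) :
    l1norm v = L + 1 := by
  obtain ⟨h1, w, hw, ha⟩ := hv
  have h2 : ¬ l1norm v ≤ L := h1
  have h3 : l1norm w ≤ L := hw
  have h4 := l1norm_sub_le v w 0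
  have h5 := ha.symm
  rw [Adj] at h5
  simp only [sub_zero] at h4
  omega

theorem isEvenDomain_ball (n : ℕ) : IsEvenDomain (ball d (2 * n + 1)) :=
  ⟨ball_finite _, fun v hv => by
    rw [l1norm_eq_of_mem_boundary_ball hv]
    exact ⟨n + 1, by ring⟩⟩

/-- The translate of `Λ` by `-u`. With this sign, `f ↦ f (· + u)` maps the configurations of `Λ` to
those of `translate u Λ`. -/
def translate (u : Vertex d) (Λ : Set (Vertex d)) : Set (Vertex d) := {v | v + u ∈ Λ}

theorem IsEvenDomain.translate {Λ : Set (Vertex d)} (hΛ : IsEvenDomain Λ) {u : Vertex d}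
    (hu : u ∈ evenLattice d) : IsEvenDomain (translate u Λ) := by
  refine ⟨hΛ.finite.preimage (add_left_injective u).injOn, ?_⟩
  rintro v ⟨hv, w, hw, ha⟩
  have hu' : Even (l1norm u) := hu
  have h := hΛ.even (v + u) ⟨hv, w + u, hw, by simpa [Adj] using ha⟩
  rw [even_l1norm_add_iff] at h
  tauto

theorem neg_mem_evenLattice {u : Vertex d} (hu : u ∈ evenLattice d) : -u ∈ evenLattice d := by
  simpa [evenLattice, l1norm_neg] using hu

theorem image_shift_configs (Λ : Set (Vertex d)) {u : Vertex d} (hu : u ∈ evenLattice d) :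
    (fun f v => f (v + u)) '' configs Λ = configs (translate u Λ) := by
  ext g
  constructor
  · rintro ⟨f, hf, rfl⟩
    refine ⟨hf.1.shift hu, fun v hv => ?_⟩
    simp only
    rw [hf.2 _ hv, parity_add hu]
  · intro hg
    have hu' := neg_mem_evenLattice hu
    refine ⟨fun v => g (v + -u), ⟨hg.1.shift hu', fun v hv => ?_⟩, ?_⟩
    · have h := hg.2 (v + -u) (by simpa [translate] using hv)
      rwa [parity_add hu'] at h
    · ext v
      simp

/-- The configurations of an even domain are in bijection with the support of its finite-volume
measure with zero boundary values. -/
theorem image_restr_configs {Λ : Set (Vertex d)} (hΛ : IsEvenDomain Λ) :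
    restr (extension Λ) '' configs Λ =
      {f | IsHeight f ∧ restrSub (boundary_subset_extension Λ) f = 0} := by
  ext g
  constructor
  · rintro ⟨f, hf, rfl⟩
    refine ⟨hf.1.isHeight_restr _, ?_⟩
    ext ⟨v, hv⟩
    exact (hf.2 v hv.1).trans (parity_of_even (hΛ.even v hv))
  · rintro ⟨hg, h0⟩
    have hb : restrSub (boundary_subset_extension Λ) g = restr (boundary Λ) parity := by
      rw [h0]
      ext ⟨v, hv⟩
      exact (parity_of_even (hΛ.even v hv)).symm
    exact ⟨glue Λ g parity, ⟨isGlobalHeight_glue hg isGlobalHeight_parity hb,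
      fun v hv => glue_of_notMem g parity hv⟩, restr_glue hb⟩

theorem injOn_restr_configs (Λ : Set (Vertex d)) :
    Set.InjOn (restr (extension Λ)) (configs Λ) := by
  intro f hf g hg hfg
  ext v
  by_cases hv : v ∈ Λ
  · exact congrFun hfg ⟨v, Or.inl hv⟩
  · rw [hf.2 v hv, hg.2 v hv]

/-! ### Signs of a height function with given absolute value -/

/-- The sign functions compatible with the absolute value `h` in the domain `Λ`. Signs live on the
odd vertices of `Λ` (they are `1` elsewhere), and all neighbours of an even vertex where `h` is
positive carry the same sign. -/
def signGroup (Λ : Set (Vertex d)) (h : Vertex d → ℤ) : Subgroup (Vertex d → ℤˣ) where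
  carrier := {σ | (∀ v, (v ∉ Λ ∨ Even (l1norm v)) → σ v = 1) ∧
    ∀ x u v, Even (l1norm x) → 0 < h x → Adj x u → Adj x v → σ u = σ v}
  mul_mem' := by
    rintro σ κ ⟨h1, h2⟩ ⟨h3, h4⟩
    refine ⟨fun v hv => by simp [h1 v hv, h3 v hv], fun x u v he hx hu hv => ?_⟩
    simp [h2 x u v he hx hu hv, h4 x u v he hx hu hv]
  one_mem' := by simp
  inv_mem' := by
    rintro σ ⟨h1, h2⟩
    refine ⟨fun v hv => by simp [h1 v hv], fun x u v he hx hu hv => ?_⟩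
    simp [h2 x u v he hx hu hv]

theorem signGroup_finite {Λ : Set (Vertex d)} (hΛ : Λ.Finite) (h : Vertex d → ℤ) :
    Finite (signGroup Λ h) := by
  have : Finite Λ := hΛ
  refine Finite.of_injective (β := Λ → ℤˣ) (fun σ v => σ.1 v.1) fun σ κ hσκ => ?_
  ext1
  ext1 v
  by_cases hv : v ∈ Λ
  · exact congrFun hσκ ⟨v, hv⟩
  · rw [σ.2.1 v (Or.inl hv), κ.2.1 v (Or.inl hv)]

open Classical in
/-- The sign of a height function at odd vertices, and `1` at even vertices. -/
noncomputable def spins (f : Vertex d → ℤ) (v : Vertex d) : ℤˣ :=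
  if ¬ Even (l1norm v) ∧ f v < 0 then -1 else 1

open Classical in
/-- An odd vertex whose sign determines that of a height function at `v`: the vertex itself if it
is odd, and a fixed neighbour of it otherwise. -/
noncomputable def oddRep [NeZero d] (v : Vertex d) : Vertex d :=
  if Even (l1norm v) then v + Pi.single 0 1 else v

theorem adj_add_single [NeZero d] (v : Vertex d) : Adj v (v + Pi.single 0 1) := by
  refine Adj.symm ?_
  simp only [Adj, add_sub_cancel_left, l1norm]
  rw [Finset.sum_eq_single 0]
  · simp
  · intro j _ hj
    simp [hj]
  · simp

theorem oddRep_odd [NeZero d] (v : Vertex d) : ¬ Even (l1norm (oddRep v)) := by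
  unfold oddRep
  split_ifs with h
  · exact (adj_add_single v).even_iff.1 h
  · exact h

/-- The height function with absolute value `h` and signs `σ`. -/
noncomputable def applySign [NeZero d] (σ : Vertex d → ℤˣ) (h : Vertex d → ℤ) (v : Vertex d) : ℤ :=
  (σ (oddRep v) : ℤ) * h v

/-- Neighbours of an even vertex have the sign of the height there. -/
theorem IsGlobalHeight.neg_iff_of_adj {f : Vertex d → ℤ} (hf : IsGlobalHeight f) {x u : Vertex d}
    (he : Even (l1norm x)) (hx : f x ≠ 0) (h : Adj x u) : f u < 0 ↔ f x < 0 := by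
  have h1 := hf.abs_sub_le_one h
  have h2 := hf.ne_zero (h.even_iff.1 he)
  have h3 := (hf.even_iff x).2 he
  rw [Int.even_iff] at h3
  rw [abs_le] at h1
  omega

theorem applySign_spins_abs [NeZero d] {f : Vertex d → ℤ} (hf : IsGlobalHeight f) :
    applySign (spins f) |f| = f := by
  ext v
  have hodd := oddRep_odd v
  simp only [applySign, spins, hodd, not_false_eq_true, true_and, Pi.abs_apply]
  have key : f v ≠ 0 → (f (oddRep v) < 0 ↔ f v < 0) := by
    intro h0
    unfold oddRep
    split_ifs with h
    · exact hf.neg_iff_of_adj h h0 (adj_add_single v)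
    · rfl
  rcases lt_trichotomy (f v) 0 with h | h | h
  · rw [if_pos ((key h.ne).2 h), abs_of_neg h]
    simp
  · simp [h]
  · rw [if_neg (fun h' => by have := (key h.ne').1 h'; omega), abs_of_pos h]
    simp

/-- The absolute values of the configurations in `Λ`. -/
def profiles (Λ : Set (Vertex d)) : Set (Vertex d → ℤ) := {h ∈ configs Λ | 0 ≤ h}

theorem abs_mem_profiles {Λ : Set (Vertex d)} {f : Vertex d → ℤ} (hf : f ∈ configs Λ) :
    |f| ∈ profiles Λ := by
  refine ⟨⟨hf.1.abs, fun v hv => ?_⟩, fun v => abs_nonneg _⟩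
  rw [Pi.abs_apply, hf.2 v hv, abs_of_nonneg (by simp only [parity]; omega)]

theorem spins_mem_signGroup {Λ : Set (Vertex d)} {f : Vertex d → ℤ} (hf : f ∈ configs Λ) :
    spins f ∈ signGroup Λ |f| := by
  refine ⟨fun v hv => ?_, fun x u v he hx hu hv => ?_⟩
  · rw [spins, if_neg]
    rintro ⟨h1, h2⟩
    rcases hv with hv | hv
    · rw [hf.2 v hv, parity_of_not_even h1] at h2
      omega
    · exact h1 hv
  · have hx' : f x ≠ 0 := by simpa using hx
    simp only [spins, hu.even_iff.1 he, hv.even_iff.1 he, hf.1.neg_iff_of_adj he hx' hu,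
      hf.1.neg_iff_of_adj he hx' hv]

theorem applySign_mem_configs [NeZero d] {Λ : Set (Vertex d)} {h : Vertex d → ℤ}
    (hh : h ∈ profiles Λ) {σ : Vertex d → ℤˣ} (hσ : σ ∈ signGroup Λ h) :
    applySign σ h ∈ configs Λ := by
  have edge : ∀ x u, Even (l1norm x) → Adj x u → |applySign σ h x - applySign σ h u| ≤ 1 := by
    intro x u he ha
    have hu := ha.even_iff.1 he
    have h1 := hh.1.1.abs_sub_le_one ha
    simp only [applySign, oddRep, he, hu, if_true, if_false]
    rcases (hh.2 x).eq_or_lt' with h0 | h0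
    · rw [h0] at h1 ⊢
      rcases Int.units_eq_one_or (σ u) with h' | h' <;> simpa [h'] using h1
    · rw [hσ.2 x (x + Pi.single 0 1) u he h0 (adj_add_single x) ha, ← mul_sub, abs_mul]
      rcases Int.units_eq_one_or (σ u) with h' | h' <;> simpa [h'] using h1
  refine ⟨.of_adj (fun v => ?_) fun u v ha => ?_, fun v hv => ?_⟩
  · have := hh.1.1.modEq v
    simp only [applySign]
    rcases Int.units_eq_one_or (σ (oddRep v)) with h' | h' <;> rw [h'] <;>
      simp only [Int.ModEq, Units.val_neg, Units.val_one] at * <;> omega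
  · by_cases hu : Even (l1norm u)
    · exact edge u v hu ha
    · rw [abs_sub_comm]
      exact edge v u (by have := ha.even_iff; tauto) ha.symm
  · simp only [applySign, oddRep]
    split_ifs with he
    · rw [hh.1.2 v hv, parity_of_even he, mul_zero]
    · rw [hσ.1 v (Or.inl hv), hh.1.2 v hv]
      simp

theorem abs_applySign [NeZero d] {h : Vertex d → ℤ} (hh : 0 ≤ h) (σ : Vertex d → ℤˣ) :
    |applySign σ h| = h := by
  ext v
  have := hh v
  simp only [Pi.abs_apply, applySign]
  rcases Int.units_eq_one_or (σ (oddRep v)) with h' | h' <;>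
    simpa [h'] using this

theorem spins_applySign [NeZero d] {Λ : Set (Vertex d)} {h : Vertex d → ℤ} (hh : h ∈ profiles Λ)
    {σ : Vertex d → ℤˣ} (hσ : σ ∈ signGroup Λ h) : spins (applySign σ h) = σ := by
  ext1 v
  by_cases he : Even (l1norm v)
  · rw [hσ.1 v (Or.inr he), spins, if_neg (by tauto)]
  · have h0 := hh.1.1.ne_zero he
    have h1 : 0 ≤ h v := hh.2 v
    simp only [spins, applySign, oddRep, he, if_false, not_false_eq_true, true_and]
    rcases Int.units_eq_one_or (σ v) with h' | h' <;> rw [h'] <;> simp <;> omega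

/-! ### Averages over configurations -/

/-- The average of `φ` over the configurations in `Λ`. -/
noncomputable def average (Λ : Set (Vertex d)) (φ : (Vertex d → ℤ) → ℝ) : ℝ :=
  (∑ᶠ f ∈ configs Λ, φ f) / (configs Λ).ncard

/-- The sum of a character over the sign functions compatible with `h`, which is the size of
`signGroup Λ h` if the character is trivial there, and `0` otherwise. -/
noncomputable def charSum (Λ : Set (Vertex d)) (χ : (Vertex d → ℤˣ) →* ℤˣ) (h : Vertex d → ℤ) :
    ℝ :=
  ∑ᶠ σ : signGroup Λ h, (((χ σ.1 : ℤˣ) : ℤ) : ℝ)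

/-- Summation over the configurations, grouped by absolute value. -/
theorem finsum_configs_eq [NeZero d] {Λ : Set (Vertex d)} (hΛ : Λ.Finite)
    (F : (Vertex d → ℤ) → ℝ) (χ : (Vertex d → ℤˣ) →* ℤˣ) :
    ∑ᶠ f ∈ configs Λ, F |f| * ((χ (spins f) : ℤ) : ℝ) =
      ∑ᶠ h ∈ profiles Λ, F h * charSum Λ χ h := by
  classical
  have hfin := configs_finite hΛ
  have hpfin : (profiles Λ).Finite := hfin.subset fun _ h => h.1
  rw [finsum_mem_eq_finite_toFinset_sum _ hfin, finsum_mem_eq_finite_toFinset_sum _ hpfin,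
    ← Finset.sum_fiberwise_of_maps_to (t := hpfin.toFinset) (g := fun f => |f|)
      (fun f hf => by simpa using abs_mem_profiles (by simpa using hf))]
  refine Finset.sum_congr rfl fun h hh => ?_
  have hh' : h ∈ profiles Λ := by simpa using hh
  have := signGroup_finite hΛ h
  have := Fintype.ofFinite (signGroup Λ h)
  rw [charSum, finsum_eq_sum_of_fintype, Finset.mul_sum]
  refine Finset.sum_bij' (fun f hf => ⟨spins f, ?_⟩) (fun σ _ => applySign σ.1 h) ?_ ?_ ?_ ?_ ?_
  · simp only [Finset.mem_filter, Set.Finite.mem_toFinset] at hf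
    rw [← hf.2]
    exact spins_mem_signGroup hf.1
  · simp
  · intro σ _
    simp only [Finset.mem_filter, Set.Finite.mem_toFinset]
    exact ⟨applySign_mem_configs hh' σ.2, abs_applySign hh'.2 _⟩
  · intro f hf
    simp only [Finset.mem_filter, Set.Finite.mem_toFinset] at hf
    simp only
    rw [← hf.2]
    exact applySign_spins_abs hf.1.1
  · intro σ _
    ext1
    exact spins_applySign hh' σ.2
  · intro f hf
    simp only [Finset.mem_filter, Set.Finite.mem_toFinset] at hf
    exact congrArg (· * ((χ (spins f) : ℤ) : ℝ)) (congrArg F hf.2)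

open Classical in
theorem charSum_eq {Λ : Set (Vertex d)} (hΛ : Λ.Finite)
    (χ : (Vertex d → ℤˣ) →* ℤˣ) (h : Vertex d → ℤ) :
    charSum Λ χ h =
      Nat.card (signGroup Λ h) * (if ∀ σ ∈ signGroup Λ h, χ σ = 1 then 1 else 0) := by
  have := signGroup_finite hΛ h
  have := Fintype.ofFinite (signGroup Λ h)
  rw [charSum, finsum_eq_sum_of_fintype]
  let ψ : signGroup Λ h →* ℝ :=
    (((Int.castRingHom ℝ : ℤ →* ℝ).comp (Units.coeHom ℤ)).comp χ).comp (signGroup Λ h).subtype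
  have hψ : ψ = 1 ↔ ∀ σ ∈ signGroup Λ h, χ σ = 1 := by
    constructor
    · intro h1 σ hσ
      have h2 : (((χ σ : ℤˣ) : ℤ) : ℝ) = 1 := DFunLike.congr_fun h1 ⟨σ, hσ⟩
      exact Units.val_eq_one.1 (Int.cast_eq_one.1 h2)
    · intro h1
      ext σ
      simp [ψ, h1 σ.1 σ.2]
  have h3 := sum_hom_units ψ
  change ∑ σ, ψ σ = _
  rw [h3, if_congr hψ rfl rfl, Nat.card_eq_fintype_card]
  split_ifs <;> simp

/-! ### Monotonicity in the domain -/

open Classical in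
/-- The restriction of sign functions to `Λ`, as a homomorphism. -/
noncomputable def truncate (Λ : Set (Vertex d)) : (Vertex d → ℤˣ) →* (Vertex d → ℤˣ) where
  toFun σ v := if v ∈ Λ then σ v else 1
  map_one' := by ext; simp
  map_mul' σ κ := by
    ext1 v
    by_cases hv : v ∈ Λ <;> simp [hv]

theorem truncate_of_mem {Λ : Set (Vertex d)} (σ : Vertex d → ℤˣ) {v : Vertex d} (hv : v ∈ Λ) :
    truncate Λ σ v = σ v := if_pos hv

theorem profiles_eq_zero {Λ : Set (Vertex d)} {a : Vertex d → ℤ} (ha : a ∈ profiles Λ)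
    {x : Vertex d} (he : Even (l1norm x)) (hx : x ∉ Λ) : a x = 0 := by
  rw [ha.1.2 x hx, parity_of_even he]

/-- Signs compatible with `b` in a larger domain truncate to signs compatible in `Λ` with
any smaller profile of `Λ`. -/
theorem truncate_mem_signGroup {Λ Λ' : Set (Vertex d)} (hΛ : IsEvenDomain Λ)
    {a b : Vertex d → ℤ} (ha : a ∈ profiles Λ) (hab : a ≤ b) {κ : Vertex d → ℤˣ}
    (hκ : κ ∈ signGroup Λ' b) : truncate Λ κ ∈ signGroup Λ a := by
  refine ⟨fun v hv => ?_, fun x u v he hx hu hv => ?_⟩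
  · by_cases hvΛ : v ∈ Λ
    · rw [truncate_of_mem κ hvΛ]
      exact hκ.1 v (Or.inr (hv.resolve_left fun h => h hvΛ))
    · exact if_neg hvΛ
  · have hxΛ : x ∈ Λ := by
      by_contra hxΛ
      rw [profiles_eq_zero ha he hxΛ] at hx
      exact lt_irrefl _ hx
    rw [truncate_of_mem κ (hΛ.mem_of_adj hxΛ he hu), truncate_of_mem κ (hΛ.mem_of_adj hxΛ he hv)]
    exact hκ.2 x u v he (hx.trans_le (hab x)) hu hv

theorem inf_mem_profiles {Λ Λ' : Set (Vertex d)} {a b : Vertex d → ℤ} (ha : a ∈ profiles Λ)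
    (hb : b ∈ profiles Λ') : a ⊓ b ∈ profiles Λ := by
  refine ⟨⟨ha.1.1.inf hb.1.1, fun v hv => ?_⟩, le_inf ha.2 hb.2⟩
  rw [Pi.inf_apply, ha.1.2 v hv]
  refine min_eq_left ((hb.1.1.parity_le_abs v).trans_eq (abs_of_nonneg (hb.2 v)))

theorem sup_mem_profiles {Λ Λ' : Set (Vertex d)} (h : Λ ⊆ Λ') {a b : Vertex d → ℤ}
    (ha : a ∈ profiles Λ) (hb : b ∈ profiles Λ') : a ⊔ b ∈ profiles Λ' := by
  refine ⟨⟨ha.1.1.sup hb.1.1, fun v hv => ?_⟩, le_sup_of_le_left ha.2⟩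
  rw [Pi.sup_apply, ha.1.2 v fun h' => hv (h h'), hb.1.2 v hv, max_self]

/-- The Holley condition for the numbers of compatible sign functions. The homomorphism
`(σ, κ) ↦ σ * truncate Λ κ` from the product of the two sign groups takes values in the sign group
of `a ⊓ b`, and its kernel embeds into that of `a ⊔ b`. -/
theorem card_signGroup_mul_le {Λ Λ' : Set (Vertex d)} (hΛ : IsEvenDomain Λ) (hΛ' : Λ'.Finite)
    {a b : Vertex d → ℤ} (ha : a ∈ profiles Λ) (hb : b ∈ profiles Λ') :
    Nat.card (signGroup Λ a) * Nat.card (signGroup Λ' b) ≤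
      Nat.card (signGroup Λ (a ⊓ b)) * Nat.card (signGroup Λ' (a ⊔ b)) := by
  have := signGroup_finite hΛ.finite a
  have := signGroup_finite hΛ' b
  have := signGroup_finite hΛ.finite (a ⊓ b)
  have := signGroup_finite hΛ' (a ⊔ b)
  let θ : signGroup Λ a × signGroup Λ' b →* (Vertex d → ℤˣ) :=
    (signGroup Λ a).subtype.coprod ((truncate Λ).comp (signGroup Λ' b).subtype)
  have hθ : ∀ p, θ p = p.1.1 * truncate Λ p.2.1 := fun p => rfl
  have hrange : θ.range ≤ signGroup Λ (a ⊓ b) := by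
    rintro _ ⟨p, rfl⟩
    rw [hθ]
    refine mul_mem ⟨p.1.2.1, fun x u v he hx hu hv => ?_⟩
      (truncate_mem_signGroup hΛ (inf_mem_profiles ha hb) inf_le_right p.2.2)
    exact p.1.2.2 x u v he (lt_min_iff.1 hx).1 hu hv
  have hker : ∀ p ∈ θ.ker, p.2.1 ∈ signGroup Λ' (a ⊔ b) := by
    intro p hp
    rw [MonoidHom.mem_ker, hθ] at hp
    refine ⟨p.2.2.1, fun x u v he hx hu hv => ?_⟩
    rcases lt_max_iff.1 hx with h | h
    · have hxΛ : x ∈ Λ := by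
        by_contra hxΛ
        rw [profiles_eq_zero ha he hxΛ] at h
        exact lt_irrefl _ h
      have h1 := congrFun hp u
      have h2 := congrFun hp v
      simp only [Pi.mul_apply, Pi.one_apply, truncate_of_mem _ (hΛ.mem_of_adj hxΛ he hu),
        truncate_of_mem _ (hΛ.mem_of_adj hxΛ he hv)] at h1 h2
      rw [p.1.2.2 x u v he h hu hv, ← h2] at h1
      exact mul_left_cancel h1
    · exact p.2.2.2 x u v he h hu hv
  have hinj : Function.Injective
      (fun p : θ.ker => (⟨p.1.2.1, hker p.1 p.2⟩ : signGroup Λ' (a ⊔ b))) := by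
    intro p q hpq
    have h2 : p.1.2 = q.1.2 := Subtype.ext (congrArg (fun σ => σ.1) hpq)
    have hp := (MonoidHom.mem_ker).1 p.2
    have hq := (MonoidHom.mem_ker).1 q.2
    rw [hθ] at hp hq
    rw [h2, ← hq] at hp
    exact Subtype.ext (Prod.ext (Subtype.ext (mul_right_cancel hp)) h2)
  have h1 := θ.ker.card_mul_index
  rw [Subgroup.index_ker, Nat.card_prod] at h1
  rw [← h1, mul_comm]
  exact Nat.mul_le_mul (Nat.card_le_card_of_injective _ (Subgroup.inclusion_injective hrange))
    (Nat.card_le_card_of_injective _ hinj)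

theorem charSum_one {Λ : Set (Vertex d)} (hΛ : Λ.Finite) (h : Vertex d → ℤ) :
    charSum Λ 1 h = Nat.card (signGroup Λ h) := by
  rw [charSum_eq hΛ]
  simp

/-- The Holley condition, weighted with a product of signs located in the smaller domain. -/
theorem charSum_mul_le {Λ Λ' : Set (Vertex d)} (hΛ : IsEvenDomain Λ) (hΛ' : Λ'.Finite)
    {χ : (Vertex d → ℤˣ) →* ℤˣ} (hχ : DependsOn χ Λ)
    {a b : Vertex d → ℤ} (ha : a ∈ profiles Λ) (hb : b ∈ profiles Λ') :
    charSum Λ χ a * charSum Λ' 1 b ≤ charSum Λ 1 (a ⊓ b) * charSum Λ' χ (a ⊔ b) := by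
  have hcard := card_signGroup_mul_le hΛ hΛ' ha hb
  rw [charSum_one hΛ', charSum_one hΛ.finite, charSum_eq hΛ.finite, charSum_eq hΛ']
  by_cases h : ∀ σ ∈ signGroup Λ a, χ σ = 1
  · have h' : ∀ σ ∈ signGroup Λ' (a ⊔ b), χ σ = 1 := by
      intro σ hσ
      rw [← h _ (truncate_mem_signGroup hΛ ha le_sup_left hσ)]
      exact hχ fun v hv => (truncate_of_mem σ hv).symm
    rw [if_pos h, if_pos h', mul_one, mul_one]
    exact_mod_cast hcard
  · rw [if_neg h]
    simp only [mul_zero, zero_mul]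
    positivity

theorem charSum_nonneg {Λ : Set (Vertex d)} (hΛ : Λ.Finite) (χ : (Vertex d → ℤˣ) →* ℤˣ)
    (h : Vertex d → ℤ) : 0 ≤ charSum Λ χ h := by
  rw [charSum_eq hΛ]
  positivity

/-- Monotonicity in the domain: the average of a nonnegative increasing function of the absolute
values times a product of signs increases with the domain. -/
theorem average_mono [NeZero d] {Λ Λ' : Set (Vertex d)} (hΛ : IsEvenDomain Λ)
    (hΛ' : IsEvenDomain Λ') (h : Λ ⊆ Λ') {F : (Vertex d → ℤ) → ℝ} (hF : Monotone F) (hF0 : 0 ≤ F)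
    {χ : (Vertex d → ℤˣ) →* ℤˣ} (hχ : DependsOn χ Λ) :
    average Λ (fun f => F |f| * ((χ (spins f) : ℤ) : ℝ)) ≤
      average Λ' (fun f => F |f| * ((χ (spins f) : ℤ) : ℝ)) := by
  classical
  have hfin : (profiles Λ).Finite := (configs_finite hΛ.finite).subset fun _ h => h.1
  have hfin' : (profiles Λ').Finite := (configs_finite hΛ'.finite).subset fun _ h => h.1
  have hcard : ∀ {M : Set (Vertex d)}, IsEvenDomain M →
      ((configs M).ncard : ℝ) = ∑ᶠ h ∈ profiles M, charSum M 1 h := by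
    intro M hM
    have h1 := finsum_configs_eq hM.finite (fun _ => 1) 1
    simp only [MonoidHom.one_apply, Units.val_one, Int.cast_one, mul_one, one_mul] at h1
    rw [← h1, finsum_mem_eq_finite_toFinset_sum _ (configs_finite hM.finite),
      Set.ncard_eq_toFinset_card _ (configs_finite hM.finite)]
    simp
  have hpos : ∀ {M : Set (Vertex d)}, IsEvenDomain M → (0 : ℝ) < (configs M).ncard := by
    intro M hM
    exact_mod_cast (Set.ncard_pos (configs_finite hM.finite)).2 ⟨_, parity_mem_configs M⟩
  rw [average, average, div_le_div_iff₀ (hpos hΛ) (hpos hΛ'), hcard hΛ, hcard hΛ',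
    finsum_configs_eq hΛ.finite, finsum_configs_eq hΛ'.finite]
  simp only [finsum_mem_eq_finite_toFinset_sum _ hfin, finsum_mem_eq_finite_toFinset_sum _ hfin']
  let f₁ : (Vertex d → ℤ) → ℝ := (profiles Λ).indicator fun a => F a * charSum Λ χ a
  let f₂ : (Vertex d → ℤ) → ℝ := (profiles Λ').indicator fun a => charSum Λ' 1 a
  let f₃ : (Vertex d → ℤ) → ℝ := (profiles Λ).indicator fun a => charSum Λ 1 a
  let f₄ : (Vertex d → ℤ) → ℝ := (profiles Λ').indicator fun a => F a * charSum Λ' χ a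
  have n₁ : 0 ≤ f₁ := fun a => Set.indicator_nonneg
    (fun a _ => mul_nonneg (hF0 a) (charSum_nonneg hΛ.finite χ a)) a
  have n₂ : 0 ≤ f₂ := fun a => Set.indicator_nonneg (fun a _ => charSum_nonneg hΛ'.finite 1 a) a
  have n₃ : 0 ≤ f₃ := fun a => Set.indicator_nonneg (fun a _ => charSum_nonneg hΛ.finite 1 a) a
  have n₄ : 0 ≤ f₄ := fun a => Set.indicator_nonneg
    (fun a _ => mul_nonneg (hF0 a) (charSum_nonneg hΛ'.finite χ a)) a
  have key : ∀ a b, f₁ a * f₂ b ≤ f₃ (a ⊓ b) * f₄ (a ⊔ b) := by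
    intro a b
    by_cases ha : a ∈ profiles Λ
    · by_cases hb : b ∈ profiles Λ'
      · simp only [f₁, f₂, f₃, f₄]
        rw [Set.indicator_of_mem ha, Set.indicator_of_mem hb,
          Set.indicator_of_mem (inf_mem_profiles ha hb),
          Set.indicator_of_mem (sup_mem_profiles h ha hb), mul_assoc,
          mul_left_comm (charSum Λ 1 (a ⊓ b))]
        exact mul_le_mul (hF le_sup_left) (charSum_mul_le hΛ hΛ'.finite hχ ha hb)
          (mul_nonneg (charSum_nonneg hΛ.finite χ a) (charSum_nonneg hΛ'.finite 1 b)) (hF0 _)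
      · rw [show f₂ b = 0 from Set.indicator_of_notMem hb _, mul_zero]
        exact mul_nonneg (n₃ _) (n₄ _)
    · rw [show f₁ a = 0 from Set.indicator_of_notMem ha _, zero_mul]
      exact mul_nonneg (n₃ _) (n₄ _)
  have hff := four_functions_theorem f₁ f₂ f₃ f₄ n₁ n₂ n₃ n₄ key hfin.toFinset hfin'.toFinset
  have e₁ : ∑ a ∈ hfin.toFinset, f₁ a = ∑ a ∈ hfin.toFinset, F a * charSum Λ χ a :=
    Finset.sum_congr rfl fun a ha => Set.indicator_of_mem (by simpa using ha) _
  have e₂ : ∑ a ∈ hfin'.toFinset, f₂ a = ∑ a ∈ hfin'.toFinset, charSum Λ' 1 a :=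
    Finset.sum_congr rfl fun a ha => Set.indicator_of_mem (by simpa using ha) _
  have e₃ : ∑ a ∈ hfin.toFinset, f₃ a = ∑ a ∈ hfin.toFinset, charSum Λ 1 a :=
    Finset.sum_congr rfl fun a ha => Set.indicator_of_mem (by simpa using ha) _
  have e₄ : ∑ a ∈ hfin'.toFinset, f₄ a = ∑ a ∈ hfin'.toFinset, F a * charSum Λ' χ a :=
    Finset.sum_congr rfl fun a ha => Set.indicator_of_mem (by simpa using ha) _
  rw [← e₁, ← e₂, ← e₃, ← e₄, mul_comm (∑ a ∈ hfin'.toFinset, f₄ a)]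
  refine hff.trans (mul_le_mul ?_ ?_ (Finset.sum_nonneg fun a _ => n₄ a)
    (Finset.sum_nonneg fun a _ => n₃ a))
  · refine Finset.sum_le_sum_of_subset_of_nonneg ?_ fun a _ _ => n₃ a
    intro c hc
    obtain ⟨a, ha, b, hb, rfl⟩ := Finset.mem_infs.1 hc
    rw [Set.Finite.mem_toFinset] at *
    exact inf_mem_profiles ha hb
  · refine Finset.sum_le_sum_of_subset_of_nonneg ?_ fun a _ _ => n₄ a
    intro c hc
    obtain ⟨a, ha, b, hb, rfl⟩ := Finset.mem_sups.1 hc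
    rw [Set.Finite.mem_toFinset] at *
    exact sup_mem_profiles h ha hb

/-! ### Convergence of averages along growing balls -/

theorem average_congr {Λ : Set (Vertex d)} {φ ψ : (Vertex d → ℤ) → ℝ}
    (h : ∀ f, IsGlobalHeight f → φ f = ψ f) : average Λ φ = average Λ ψ := by
  rw [average, average]
  congr 1
  exact finsum_mem_congr rfl fun f hf => h f hf.1

theorem average_add [NeZero d] {Λ : Set (Vertex d)} (hΛ : Λ.Finite) (φ ψ : (Vertex d → ℤ) → ℝ) :
    average Λ (φ + ψ) = average Λ φ + average Λ ψ := by
  rw [average, average, average, ← add_div]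
  congr 1
  exact finsum_mem_add_distrib (configs_finite hΛ)

theorem average_smul [NeZero d] {Λ : Set (Vertex d)} (hΛ : Λ.Finite) (c : ℝ)
    (φ : (Vertex d → ℤ) → ℝ) : average Λ (c • φ) = c * average Λ φ := by
  rw [average, average, ← mul_div_assoc]
  congr 1
  simp only [finsum_mem_eq_finite_toFinset_sum _ (configs_finite hΛ), Finset.mul_sum,
    Pi.smul_apply, smul_eq_mul]

theorem average_le [NeZero d] {Λ : Set (Vertex d)} (hΛ : Λ.Finite) {φ : (Vertex d → ℤ) → ℝ}
    {C : ℝ} (h : ∀ f, φ f ≤ C) : average Λ φ ≤ C := by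
  have hfin := configs_finite hΛ
  have hpos : (0 : ℝ) < (configs Λ).ncard := by
    exact_mod_cast (Set.ncard_pos hfin).2 ⟨_, parity_mem_configs Λ⟩
  rw [average, div_le_iff₀ hpos, finsum_mem_eq_finite_toFinset_sum _ hfin,
    Set.ncard_eq_toFinset_card _ hfin]
  refine (Finset.sum_le_card_nsmul _ _ C fun f _ => h f).trans_eq ?_
  rw [nsmul_eq_mul, mul_comm]

theorem average_translate {u : Vertex d} (hu : u ∈ evenLattice d) (Λ : Set (Vertex d))
    (φ : (Vertex d → ℤ) → ℝ) :
    average (translate u Λ) φ = average Λ fun f => φ fun v => f (v + u) := by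
  have hinj : Function.Injective fun (f : Vertex d → ℤ) v => f (v + u) := by
    intro f g hfg
    ext v
    simpa using congrFun hfg (v - u)
  rw [average, average, ← image_shift_configs Λ hu, Set.ncard_image_of_injective _ hinj,
    finsum_mem_image hinj.injOn]

/-- The functions `f ↦ F |f| * χ (sign f)` with `F` nonnegative, bounded and increasing, and
`χ` a product of finitely many signs. -/
def signedMonotone (d : ℕ) : Submonoid ((Vertex d → ℤ) → ℝ) where
  carrier := {φ | ∃ (F : (Vertex d → ℤ) → ℝ) (χ : (Vertex d → ℤˣ) →* ℤˣ) (T : Set (Vertex d)),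
    Monotone F ∧ 0 ≤ F ∧ (∃ C, ∀ h, F h ≤ C) ∧ T.Finite ∧ DependsOn χ T ∧
      φ = fun f => F |f| * ((χ (spins f) : ℤ) : ℝ)}
  one_mem' := ⟨1, 1, ∅, monotone_const, zero_le_one, ⟨1, fun _ => le_rfl⟩, Set.finite_empty,
    fun _ _ _ => rfl, by ext; simp⟩
  mul_mem' := by
    rintro _ _ ⟨F, χ, T, h1, h2, ⟨C, h3⟩, h4, h5, rfl⟩
      ⟨F', χ', T', h1', h2', ⟨C', h3'⟩, h4', h5', rfl⟩
    refine ⟨F * F', χ * χ', T ∪ T', h1.mul h1' h2 h2', mul_nonneg h2 h2', ⟨C * C', fun h => ?_⟩,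
      h4.union h4', fun x y hxy => ?_, ?_⟩
    · exact mul_le_mul (h3 h) (h3' h) (h2' h) ((h2 h).trans (h3 h))
    · rw [MonoidHom.mul_apply, MonoidHom.mul_apply, h5 fun i hi => hxy i (Or.inl hi),
        h5' fun i hi => hxy i (Or.inr hi)]
    · ext f
      simp only [Pi.mul_apply, MonoidHom.mul_apply, Units.val_mul, Int.cast_mul]
      ring

theorem ball_subset_ball {m n : ℕ} (h : m ≤ n) : ball d m ⊆ ball d n :=
  fun _ hv => le_trans (show l1norm _ ≤ m from hv) h

theorem exists_subset_ball {T : Set (Vertex d)} (hT : T.Finite) : ∃ n, T ⊆ ball d (2 * n + 1) := by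
  obtain ⟨N, hN⟩ := (hT.image l1norm).bddAbove
  refine ⟨N, fun v hv => ?_⟩
  have : l1norm v ≤ N := hN ⟨v, hv, rfl⟩
  exact show l1norm v ≤ _ by omega

theorem ball_subset_translate (u : Vertex d) (n : ℕ) :
    ball d (2 * n + 1) ⊆ translate u (ball d (2 * (n + l1norm u) + 1)) := by
  intro v hv
  have h1 : l1norm v ≤ 2 * n + 1 := hv
  have h2 := l1norm_add_le v u
  exact show l1norm (v + u) ≤ _ by omega

theorem translate_subset_ball (u : Vertex d) (n : ℕ) :
    translate u (ball d (2 * n + 1)) ⊆ ball d (2 * (n + l1norm u) + 1) := by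
  intro v hv
  have h1 : l1norm (v + u) ≤ 2 * n + 1 := hv
  have h2 := l1norm_add_le (v + u) (-u)
  rw [add_neg_cancel_right, l1norm_neg] at h2
  exact show l1norm v ≤ _ by omega

/-- Averages of `F |f| * χ (sign f)` increase along balls, hence converge, and translates of balls
are sandwiched between balls. -/
theorem tendsto_average_of_mem_signedMonotone [NeZero d] {φ : (Vertex d → ℤ) → ℝ}
    (hφ : φ ∈ signedMonotone d) {u : Vertex d} (hu : u ∈ evenLattice d) :
    ∃ l, Tendsto (fun n => average (ball d (2 * n + 1)) φ) atTop (𝓝 l) ∧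
      Tendsto (fun n => average (translate u (ball d (2 * n + 1))) φ) atTop (𝓝 l) := by
  obtain ⟨F, χ, T, hF, hF0, ⟨C, hC⟩, hT, hχ, rfl⟩ := hφ
  set φ : (Vertex d → ℤ) → ℝ := fun f => F |f| * ((χ (spins f) : ℤ) : ℝ) with hφ
  obtain ⟨N, hN⟩ := exists_subset_ball hT
  set k := l1norm u
  have dep : ∀ {Λ : Set (Vertex d)}, ball d (2 * N + 1) ⊆ Λ → DependsOn χ Λ :=
    fun h x y hxy => hχ fun i hi => hxy i (h (hN hi))
  have hbound : ∀ f, φ f ≤ C := by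
    intro f
    have h1 := hF0 |f|
    have h2 := hC |f|
    simp only [hφ]
    simp only [Pi.zero_apply] at h1
    rcases Int.units_eq_one_or (χ (spins f)) with h' | h' <;> rw [h'] <;> simp <;> linarith
  have hmono : Monotone fun n => average (ball d (2 * (n + N) + 1)) φ := by
    intro m n hmn
    exact average_mono (isEvenDomain_ball _) (isEvenDomain_ball _) (ball_subset_ball (by omega))
      hF hF0 (dep (ball_subset_ball (by omega)))
  have hlim := tendsto_atTop_ciSup hmono
    ⟨C, by rintro _ ⟨n, rfl⟩; exact average_le (ball_finite _) hbound⟩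
  refine ⟨_, (tendsto_add_atTop_iff_nat N).1 hlim, (tendsto_add_atTop_iff_nat (N + k)).1 ?_⟩
  refine tendsto_of_tendsto_of_tendsto_of_le_of_le hlim
    (hlim.comp (tendsto_add_atTop_nat (k + k))) (fun n => ?_) fun n => ?_
  · have hsub := ball_subset_translate u (n + N)
    rw [show n + N + l1norm u = n + (N + k) by simp only [k]; ring] at hsub
    exact average_mono (isEvenDomain_ball _) ((isEvenDomain_ball _).translate hu) hsub
      hF hF0 (dep (ball_subset_ball (by omega)))
  · have hsub := translate_subset_ball u (n + (N + k))
    rw [show n + (N + k) + l1norm u = n + (k + k) + N by simp only [k]; ring] at hsub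
    refine average_mono ((isEvenDomain_ball _).translate hu) (isEvenDomain_ball _) hsub
      hF hF0 (dep ?_)
    rw [← add_assoc]
    exact (ball_subset_ball (by omega)).trans (ball_subset_translate u (n + N))

theorem tendsto_average_of_mem_adjoin [NeZero d] {φ : (Vertex d → ℤ) → ℝ}
    (hφ : φ ∈ Algebra.adjoin ℝ (signedMonotone d : Set ((Vertex d → ℤ) → ℝ)))
    {u : Vertex d} (hu : u ∈ evenLattice d) :
    ∃ l, Tendsto (fun n => average (ball d (2 * n + 1)) φ) atTop (𝓝 l) ∧
      Tendsto (fun n => average (translate u (ball d (2 * n + 1))) φ) atTop (𝓝 l) := by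
  rw [← Subalgebra.mem_toSubmodule, Algebra.adjoin_eq_span, Submonoid.closure_eq] at hφ
  have hfin : ∀ n, (translate u (ball d (2 * n + 1))).Finite :=
    fun n => ((isEvenDomain_ball n).translate hu).finite
  induction hφ using Submodule.span_induction with
  | mem φ h => exact tendsto_average_of_mem_signedMonotone h hu
  | zero => exact ⟨0, by simp [average], by simp [average]⟩
  | add φ ψ _ _ h1 h2 =>
    obtain ⟨l, h3, h4⟩ := h1
    obtain ⟨m, h5, h6⟩ := h2
    simp only [average_add (ball_finite _), average_add (hfin _)]
    exact ⟨l + m, h3.add h5, h4.add h6⟩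
  | smul c φ _ h =>
    obtain ⟨l, h1, h2⟩ := h
    simp only [average_smul (ball_finite _), average_smul (hfin _)]
    exact ⟨c * l, h1.const_mul c, h2.const_mul c⟩

/-- The event `f v = k` is expressed through increasing functions of `|f|` and the sign of `f` at
`oddRep v`. -/
theorem exists_mem_adjoin_eq_indicator [NeZero d] (v : Vertex d) (k : ℤ) :
    ∃ e ∈ Algebra.adjoin ℝ (signedMonotone d : Set ((Vertex d → ℤ) → ℝ)),
      ∀ f, IsGlobalHeight f → e f = if f v = k then 1 else 0 := by
  set A := Algebra.adjoin ℝ (signedMonotone d : Set ((Vertex d → ℤ) → ℝ))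
  let g : ℤ → (Vertex d → ℤ) → ℝ := fun m f => if m ≤ |f v| then 1 else 0
  let s : (Vertex d → ℤ) → ℝ := fun f => ((spins f (oddRep v) : ℤ) : ℝ)
  have hg : ∀ m, g m ∈ A := by
    intro m
    refine Algebra.subset_adjoin ⟨fun h => if m ≤ h v then 1 else 0, 1, ∅, ?_, ?_, ⟨1, ?_⟩,
      Set.finite_empty, fun _ _ _ => rfl, ?_⟩
    · intro h h' hh
      have := hh v
      simp only
      split_ifs with h1 h2
      exacts [le_rfl, absurd (h1.trans this) h2, zero_le_one, le_rfl]
    · intro h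
      simp only [Pi.zero_apply]
      split_ifs <;> norm_num
    · intro h
      simp only
      split_ifs <;> norm_num
    · ext f
      simp only [g, MonoidHom.one_apply, Units.val_one, Int.cast_one, mul_one]
      rfl
  have hs : s ∈ A := by
    refine Algebra.subset_adjoin ⟨1, Pi.evalMonoidHom _ (oddRep v), {oddRep v}, monotone_const,
      zero_le_one, ⟨1, fun _ => le_rfl⟩, Set.finite_singleton _, fun x y hxy => hxy _ rfl, ?_⟩
    ext f
    simp [s]
  have hval : ∀ f, IsGlobalHeight f → (spins f (oddRep v) : ℤ) * |f v| = f v :=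
    fun f hf => congrFun (applySign_spins_abs hf) v
  by_cases hk : k = 0
  · refine ⟨g 0 - g 1, sub_mem (hg 0) (hg 1), fun f _ => ?_⟩
    simp only [Pi.sub_apply, g, hk]
    by_cases h0 : f v = 0
    · simp [h0]
    · have : 1 ≤ |f v| := Int.one_le_abs h0
      simp [h0, this]
  · refine ⟨(g |k| - g (|k| + 1)) * ((1 / 2 : ℝ) • (1 + (k.sign : ℝ) • s)),
      mul_mem (sub_mem (hg _) (hg _)) (A.smul_mem (add_mem (one_mem A) (A.smul_mem hs _)) _),
      fun f hf => ?_⟩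
    have h1 := hval f hf
    have h2 := abs_nonneg (f v)
    simp only [Pi.mul_apply, Pi.sub_apply, Pi.smul_apply, Pi.add_apply, Pi.one_apply, smul_eq_mul,
      g, s]
    rcases lt_or_gt_of_ne hk with hk | hk
    · rw [Int.sign_eq_neg_one_of_neg hk, abs_of_neg hk]
      rcases Int.units_eq_one_or (spins f (oddRep v)) with h | h <;> rw [h] at h1 ⊢ <;>
        simp only [Units.val_one, Units.val_neg] at h1 ⊢ <;> split_ifs <;>
        first | omega | norm_num
    · rw [Int.sign_eq_one_of_pos hk, abs_of_pos hk]
      rcases Int.units_eq_one_or (spins f (oddRep v)) with h | h <;> rw [h] at h1 ⊢ <;>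
        simp only [Units.val_one, Units.val_neg] at h1 ⊢ <;> split_ifs <;>
        first | omega | norm_num

/-- The functions on the lattice that take the values `a` on `I`. -/
def pinned {ι : Type*} (I : Finset ι) (a : ι → ℤ) : Set (ι → ℤ) := {f | ∀ v ∈ I, f v = a v}

theorem tendsto_average_pinned [NeZero d] (I : Finset (Vertex d)) (a : Vertex d → ℤ)
    {u : Vertex d} (hu : u ∈ evenLattice d) :
    ∃ l, Tendsto (fun n => average (ball d (2 * n + 1)) ((pinned I a).indicator 1)) atTop (𝓝 l) ∧
      Tendsto (fun n => average (translate u (ball d (2 * n + 1))) ((pinned I a).indicator 1))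
        atTop (𝓝 l) := by
  classical
  choose e he he' using fun v : Vertex d => exists_mem_adjoin_eq_indicator v (a v)
  have h1 : ∀ f, IsGlobalHeight f → (∏ v ∈ I, e v) f = (pinned I a).indicator 1 f := by
    intro f hf
    rw [Finset.prod_apply, Finset.prod_congr rfl fun v _ => he' v f hf, Finset.prod_ite_zero]
    simp [pinned, Set.indicator_apply]
  simp only [← average_congr h1]
  exact tendsto_average_of_mem_adjoin (Subalgebra.prod_mem _ fun v _ => he v) hu

/-! ### Uniform measures -/

theorem integral_uniformOn {Ω : Type*} [MeasurableSpace Ω] [MeasurableSingletonClass Ω] {s : Set Ω}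
    (hs : s.Finite) (φ : Ω → ℝ) : ∫ f, φ f ∂(uniformOn s) = (∑ᶠ f ∈ s, φ f) / s.ncard := by
  have hint : IntegrableOn φ (hs.toFinset : Set Ω) Measure.count := by
    have : IsFiniteMeasure (Measure.count.restrict s) :=
      isFiniteMeasure_restrict.2 (Measure.count_apply_lt_top.2 hs).ne
    have h := IntegrableOn.of_finite (f := φ) (μ := Measure.count.restrict s) hs
    rw [IntegrableOn, Measure.restrict_restrict hs.measurableSet, Set.inter_self] at h
    rwa [hs.coe_toFinset]
  have h1 := setIntegral_finset hs.toFinset hint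
  rw [hs.coe_toFinset] at h1
  rw [uniformOn, ProbabilityTheory.cond, integral_smul_measure, h1,
    Measure.count_apply_finite s hs, finsum_mem_eq_finite_toFinset_sum _ hs,
    Set.ncard_eq_toFinset_card s hs]
  simp [measureReal_def, div_eq_inv_mul]

theorem map_uniformOn {Ω Ω' : Type*} [MeasurableSpace Ω] [MeasurableSingletonClass Ω]
    [MeasurableSpace Ω'] [MeasurableSingletonClass Ω'] {s : Set Ω} (hs : s.Finite) {g : Ω → Ω'}
    (hg : Measurable g) (hinj : Set.InjOn g s) :
    (uniformOn s).map g = uniformOn (g '' s) := by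
  ext A hA
  have hs' := hs.image g
  rw [Measure.map_apply hg hA, uniformOn, uniformOn, cond_apply hs.measurableSet,
    cond_apply hs'.measurableSet, Measure.count_apply hs.measurableSet,
    Measure.count_apply hs'.measurableSet, Measure.count_apply (hs.measurableSet.inter (hg hA)),
    Measure.count_apply (hs'.measurableSet.inter hA), hinj.encard_image, ← Set.image_inter_preimage,
    (hinj.mono Set.inter_subset_left).encard_image]

theorem measurable_restr (S : Set (Vertex d)) : Measurable (restr S) :=
  measurable_pi_lambda _ fun v => measurable_pi_apply v.1

theorem finiteVolume_zero_eq_map [NeZero d] {Λ : Set (Vertex d)} (hΛ : IsEvenDomain Λ) :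
    finiteVolume Λ 0 = (uniformOn (configs Λ)).map (restr (extension Λ)) := by
  rw [map_uniformOn (configs_finite hΛ.finite) (measurable_restr _) (injOn_restr_configs Λ),
    image_restr_configs hΛ]
  rfl

/-- The law `μ^{Λ(L),0}`, `L = 2n + 1`, as a probability measure on functions on the lattice, which
are equal to `parity` off the ball. -/
noncomputable def ballLaw (d : ℕ) [NeZero d] (n : ℕ) : ProbabilityMeasure (Vertex d → ℤ) :=
  ⟨uniformOn (configs (ball d (2 * n + 1))),
    isProbabilityMeasure_uniformOn (configs_finite (ball_finite _)) ⟨_, parity_mem_configs _⟩⟩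

theorem integral_ballLaw [NeZero d] (n : ℕ) (φ : (Vertex d → ℤ) → ℝ) :
    ∫ f, φ f ∂(ballLaw d n : Measure (Vertex d → ℤ)) = average (ball d (2 * n + 1)) φ :=
  integral_uniformOn (configs_finite (ball_finite _)) φ

theorem supTail_eq [NeZero d] (M : ℕ) :
    supTail d M = ⨆ n, (ballLaw d n : Measure (Vertex d → ℤ)) {f | (M : ℤ) < |f 0|} := by
  refine iSup_congr fun n => ?_
  rw [finiteVolume_zero_eq_map (isEvenDomain_ball n), Measure.map_apply (measurable_restr _)]
  · rfl
  · exact measurableSet_lt measurable_const (measurable_pi_apply _).abs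

/-! ### Cylinder events -/

theorem pinned_eq_preimage {ι : Type*} (I : Finset ι) (a : ι → ℤ) :
    pinned I a = I.restrict ⁻¹' ({I.restrict a} : Set (I → ℤ)) := by
  ext f
  simp [pinned, funext_iff]

theorem measurableSet_pinned {ι : Type*} (I : Finset ι) (a : ι → ℤ) :
    MeasurableSet (pinned I a) := by
  rw [pinned_eq_preimage]
  exact Finset.measurable_restrict I (measurableSet_singleton _)

/-- A finite measure on integer-valued functions is determined by the cylinder events prescribing
finitely many values. -/
theorem ext_of_pinned {ι : Type*} {μ ν : Measure (ι → ℤ)} [IsFiniteMeasure μ]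
    (h : ∀ (I : Finset ι) (a : ι → ℤ), μ (pinned I a) = ν (pinned I a)) : μ = ν := by
  classical
  refine IsProjectiveLimit.unique (P := fun I => μ.map I.restrict) (fun _ => rfl) fun I => ?_
  refine Measure.ext_of_singleton fun c => ?_
  have hc : I.restrict (fun i => if hi : i ∈ I then c ⟨i, hi⟩ else 0) = c := by
    ext i
    simp
  rw [Measure.map_apply (Finset.measurable_restrict I) (measurableSet_singleton _),
    Measure.map_apply (Finset.measurable_restrict I) (measurableSet_singleton _), ← hc,
    ← pinned_eq_preimage, h]

/-- Functions of finitely many integer coordinates are continuous. -/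
theorem continuous_of_dependsOn {ι β : Type*} [TopologicalSpace β] [Nonempty β]
    {φ : (ι → ℤ) → β} {T : Set ι} (hT : T.Finite) (h : DependsOn φ T) : Continuous φ := by
  have : Finite T := hT
  obtain ⟨ψ, rfl⟩ := (dependsOn_iff_exists_comp).1 h
  exact continuous_of_discreteTopology.comp (by fun_prop)

theorem dependsOn_pinned {ι : Type*} (I : Finset ι) (a : ι → ℤ) :
    DependsOn (fun f => f ∈ pinned I a) (I : Set ι) := by
  intro f g hfg
  simp only [pinned, Set.mem_ofPred_eq, eq_iff_iff]
  exact forall₂_congr fun v hv => by rw [hfg v hv]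

/-- Weak convergence gives convergence of averages of bounded functions of finitely many
coordinates. -/
theorem tendsto_integral_of_dependsOn {m : ℕ → ProbabilityMeasure (Vertex d → ℤ)}
    {μ : ProbabilityMeasure (Vertex d → ℤ)} {l : Filter ℕ} (h : Tendsto m l (𝓝 μ))
    {φ : (Vertex d → ℤ) → ℝ} {T : Set (Vertex d)} (hT : T.Finite) (hφ : DependsOn φ T) {C : ℝ}
    (hC : ∀ f, |φ f| ≤ C) :
    Tendsto (fun n => ∫ f, φ f ∂(m n : Measure (Vertex d → ℤ))) l (𝓝 (∫ f, φ f ∂μ)) :=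
  ProbabilityMeasure.tendsto_iff_forall_integral_tendsto.1 h
    (BoundedContinuousFunction.ofNormedAddCommGroup φ (continuous_of_dependsOn hT hφ) C hC)

theorem dependsOn_indicator {ι : Type*} {s : Set (ι → ℤ)} {T : Set ι}
    (h : DependsOn (fun f => f ∈ s) T) : DependsOn (s.indicator (1 : (ι → ℤ) → ℝ)) T := by
  classical
  intro f g hfg
  have : f ∈ s ↔ g ∈ s := iff_of_eq (h hfg)
  simp only [Set.indicator_apply, this, Pi.one_apply]

theorem abs_indicator_one_le {Ω : Type*} (s : Set Ω) (f : Ω) :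
    |s.indicator (1 : Ω → ℝ) f| ≤ 1 := by
  classical
  rw [Set.indicator_apply]
  split_ifs <;> simp

theorem measurableSet_of_dependsOn {ι : Type*} [Countable ι] {s : Set (ι → ℤ)} {T : Set ι}
    (hT : T.Finite) (h : DependsOn (fun f => f ∈ s) T) : MeasurableSet s := by
  have hc := continuous_of_dependsOn hT (dependsOn_indicator h)
  have : s = s.indicator (1 : (ι → ℤ) → ℝ) ⁻¹' {1} := by
    classical
    ext f
    simp [Set.indicator_apply]
  rw [this]
  exact hc.measurable (measurableSet_singleton _)

/-! ### The infinite-volume limit -/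

/-- Tightness at the origin suffices: by the Lipschitz property, a bound on the height at the origin
confines a height function to a product of finite intervals. -/
theorem isTightMeasureSet_range_ballLaw [NeZero d] (h : Tendsto (supTail d) atTop (𝓝 0)) :
    IsTightMeasureSet {((μ : ProbabilityMeasure (Vertex d → ℤ)) : Measure (Vertex d → ℤ)) |
      μ ∈ Set.range (ballLaw d)} := by
  rw [isTightMeasureSet_iff_exists_isCompact_measure_compl_le]
  intro ε hε
  obtain ⟨M, hM⟩ := ((tendsto_order.1 h).2 ε hε).exists
  refine ⟨Set.univ.pi fun v => Set.Icc (-(M + l1norm v : ℤ)) (M + l1norm v),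
    isCompact_univ_pi fun v => (Set.finite_Icc _ _).isCompact, ?_⟩
  rintro _ ⟨_, ⟨n, rfl⟩, rfl⟩
  rw [supTail_eq] at hM
  refine le_trans ?_ ((le_iSup _ n).trans hM.le)
  have hfin : (configs (ball d (2 * n + 1))).Finite := configs_finite (ball_finite _)
  change uniformOn (configs (ball d (2 * n + 1))) _ ≤ uniformOn (configs (ball d (2 * n + 1))) _
  rw [← uniformOn_inter_self hfin]
  refine measure_mono ?_
  rintro f ⟨hf, hfK⟩
  by_contra hle
  have h0 : |f 0| ≤ M := not_lt.1 hle
  refine hfK fun v _ => abs_le.1 ?_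
  have := hf.1.abs_le_abs_add v 0
  rw [sub_zero] at this
  linarith

/-- If the heights at the origin are tight, the finite-volume measures converge weakly: Prokhorov's
theorem gives limit points, and the probabilities of cylinder events converge. -/
theorem exists_tendsto_ballLaw [NeZero d] (h : Tendsto (supTail d) atTop (𝓝 0)) :
    ∃ μ : ProbabilityMeasure (Vertex d → ℤ), Tendsto (ballLaw d) atTop (𝓝 μ) := by
  have hK := isCompact_closure_of_isTightMeasureSet (isTightMeasureSet_range_ballLaw h)
  have hmem : ∀ n, ballLaw d n ∈ closure (Set.range (ballLaw d)) := fun n =>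
    subset_closure ⟨n, rfl⟩
  obtain ⟨μ, _, hμ⟩ := hK.exists_mapClusterPt (f := atTop) (u := ballLaw d)
    (tendsto_principal.2 (Eventually.of_forall hmem))
  refine ⟨μ, hK.tendsto_nhds_of_unique_mapClusterPt (Eventually.of_forall hmem) fun ν _ hν => ?_⟩
  have value : ∀ {ρ : ProbabilityMeasure (Vertex d → ℤ)}, MapClusterPt ρ atTop (ballLaw d) →
      ∀ I a l, Tendsto (fun n => average (ball d (2 * n + 1)) ((pinned I a).indicator 1))
        atTop (𝓝 l) → (ρ : Measure (Vertex d → ℤ)).real (pinned I a) = l := by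
    intro ρ hρ I a l hl
    have hdep := dependsOn_indicator (dependsOn_pinned I a)
    have hcont : Continuous fun ρ : ProbabilityMeasure (Vertex d → ℤ) =>
        ∫ f, (pinned I a).indicator 1 f ∂(ρ : Measure (Vertex d → ℤ)) :=
      ProbabilityMeasure.continuous_integral_boundedContinuousFunction
        (BoundedContinuousFunction.ofNormedAddCommGroup
          ((pinned I a).indicator (1 : (Vertex d → ℤ) → ℝ))
          (continuous_of_dependsOn I.finite_toSet hdep) 1 (abs_indicator_one_le _))
    have h1 := hρ.continuousAt_comp hcont.continuousAt
    have h2 : Tendsto ((fun ρ : ProbabilityMeasure (Vertex d → ℤ) =>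
        ∫ f, (pinned I a).indicator 1 f ∂(ρ : Measure (Vertex d → ℤ))) ∘ ballLaw d)
        atTop (𝓝 l) := by
      refine hl.congr fun n => (integral_ballLaw n _).symm
    have h3 : (∫ f, (pinned I a).indicator 1 f ∂(ρ : Measure (Vertex d → ℤ))) = l := by
      have : NeBot (𝓝 (∫ f, (pinned I a).indicator 1 f ∂(ρ : Measure (Vertex d → ℤ))) ⊓ 𝓝 l) :=
        (h1 : ClusterPt _ _).neBot.mono (inf_le_inf_left _ h2)
      exact eq_of_nhds_neBot this
    rw [← h3, integral_indicator_one (measurableSet_pinned I a)]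
  refine Subtype.ext ?_
  have : IsFiniteMeasure ν.1 := inferInstanceAs (IsFiniteMeasure (ν : Measure (Vertex d → ℤ)))
  refine ext_of_pinned fun I a => ?_
  obtain ⟨l, hl, _⟩ := tendsto_average_pinned I a (u := 0) (by simp [evenLattice, l1norm])
  have := (value hν I a l hl).trans (value hμ I a l hl).symm
  rwa [measureReal_def, measureReal_def, ENNReal.toReal_eq_toReal_iff' (measure_ne_top _ _)
    (measure_ne_top _ _)] at this

/-- Cylinder probabilities have the same limit along balls and along translated balls, so the limit
measure is invariant. -/
theorem isTranslationInvariant_of_tendsto [NeZero d] {μ : ProbabilityMeasure (Vertex d → ℤ)}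
    (h : Tendsto (ballLaw d) atTop (𝓝 μ)) :
    IsTranslationInvariant (evenLattice d) (μ : Measure (Vertex d → ℤ)) := by
  intro u hu
  have hmeas : Measurable fun (f : Vertex d → ℤ) v => f (v + u) :=
    measurable_pi_lambda _ fun v => measurable_pi_apply (v + u)
  have := Measure.isProbabilityMeasure_map (μ := (μ : Measure (Vertex d → ℤ))) hmeas.aemeasurable
  refine ext_of_pinned fun I a => ?_
  have hset := measurableSet_pinned I a
  rw [Measure.map_apply hmeas hset]
  have hdep := dependsOn_pinned I a
  have hdep' : DependsOn (fun f => f ∈ (fun (f : Vertex d → ℤ) v => f (v + u)) ⁻¹' pinned I a)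
      ((fun v => v + u) '' (I : Set (Vertex d))) := by
    intro f g hfg
    exact hdep fun v hv => hfg _ ⟨v, hv, rfl⟩
  have h1 := tendsto_integral_of_dependsOn h I.finite_toSet (dependsOn_indicator hdep)
    (abs_indicator_one_le _)
  have h2 := tendsto_integral_of_dependsOn h (I.finite_toSet.image _) (dependsOn_indicator hdep')
    (abs_indicator_one_le _)
  obtain ⟨l, h3, h4⟩ := tendsto_average_pinned I a hu
  simp only [integral_ballLaw] at h1 h2
  simp only [average_translate hu] at h4
  have h5 := (tendsto_nhds_unique h2 h4).trans (tendsto_nhds_unique h1 h3).symm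
  rwa [integral_indicator_one (hmeas hset), integral_indicator_one hset, measureReal_def,
    measureReal_def, ENNReal.toReal_eq_toReal_iff' (measure_ne_top _ _) (measure_ne_top _ _)] at h5

theorem convergesInDistribution_of_tendsto [NeZero d] {μ : ProbabilityMeasure (Vertex d → ℤ)}
    (h : Tendsto (ballLaw d) atTop (𝓝 μ)) :
    ConvergesInDistribution (fun n => ball d (2 * n + 1)) (fun _ => 0)
      (μ : Measure (Vertex d → ℤ)) := by
  intro S hS φ ε hε
  have : Finite S := hS
  have hdep : DependsOn (fun f => φ (restr S f)) S := by
    intro f g hfg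
    exact congrArg φ (funext fun v => hfg v.1 v.2)
  have h1 := tendsto_integral_of_dependsOn h hS hdep (C := ‖φ‖) fun f => φ.norm_coe_le_norm _
  obtain ⟨N, hN⟩ := exists_subset_ball hS
  filter_upwards [(Metric.tendsto_nhds.1 h1) ε hε, eventually_ge_atTop N] with n hn hNn
  have hsub : S ⊆ extension (ball d (2 * n + 1)) :=
    (hN.trans (ball_subset_ball (by omega))).trans Set.subset_union_left
  refine ⟨hsub, ?_⟩
  have hr : Measurable (restrSub hsub : (_ → ℤ) → (S → ℤ)) :=
    measurable_pi_lambda _ fun v => measurable_pi_apply _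
  have hφ : ∀ ν : Measure (S → ℤ), AEStronglyMeasurable φ ν := fun ν =>
    φ.continuous.aestronglyMeasurable
  rw [finiteVolume_zero_eq_map (isEvenDomain_ball n), Measure.map_map hr (measurable_restr _),
    integral_map (hr.comp (measurable_restr _)).aemeasurable (hφ _),
    integral_map (measurable_restr _).aemeasurable (hφ _)]
  exact hn

theorem ae_isGlobalHeight_of_tendsto [NeZero d] {μ : ProbabilityMeasure (Vertex d → ℤ)}
    (h : Tendsto (ballLaw d) atTop (𝓝 μ)) :
    ∀ᵐ f ∂(μ : Measure (Vertex d → ℤ)), IsGlobalHeight f := by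
  have key : ∀ (T : Set (Vertex d)) (s : Set (Vertex d → ℤ)), T.Finite →
      DependsOn (fun f => f ∈ s) T → (∀ f, IsGlobalHeight f → f ∈ s) →
      ∀ᵐ f ∂(μ : Measure (Vertex d → ℤ)), f ∈ s := by
    intro T s hT hs hmem
    have hms := measurableSet_of_dependsOn hT hs
    have h1 := tendsto_integral_of_dependsOn h hT (dependsOn_indicator hs) (abs_indicator_one_le _)
    have h2 : ∀ n, ∫ f, s.indicator 1 f ∂(ballLaw d n : Measure (Vertex d → ℤ)) = (1 : ℝ) := by
      intro n
      have h3 : average (ball d (2 * n + 1)) (s.indicator 1) =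
          average (ball d (2 * n + 1)) fun _ => 1 :=
        average_congr fun f hf => Set.indicator_of_mem (hmem f hf) _
      rw [integral_ballLaw, h3, ← integral_ballLaw]
      simp
    simp only [h2] at h1
    have h4 := tendsto_nhds_unique h1 tendsto_const_nhds
    rw [integral_indicator_one hms] at h4
    rw [measureReal_def, ENNReal.toReal_eq_one_iff] at h4
    exact (prob_compl_eq_zero_iff hms).2 h4
  have h1 : ∀ᵐ f ∂(μ : Measure (Vertex d → ℤ)), ∀ u v : Vertex d,
      |f u - f v| ≤ (l1norm (u - v) : ℤ) := by
    refine ae_all_iff.2 fun u => ae_all_iff.2 fun v => ?_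
    refine key {u, v} {f | |f u - f v| ≤ (l1norm (u - v) : ℤ)} (by simp) (fun f g hfg => ?_)
      fun f hf => hf.lipschitz u v
    simp only [Set.mem_ofPred_eq, hfg u (by simp), hfg v (by simp)]
  have h2 : ∀ᵐ f ∂(μ : Measure (Vertex d → ℤ)), ∀ v : Vertex d,
      f v ≡ (l1norm v : ℤ) [ZMOD 2] := by
    refine ae_all_iff.2 fun v => ?_
    refine key {v} {f | f v ≡ (l1norm v : ℤ) [ZMOD 2]} (by simp) (fun f g hfg => ?_)
      fun f hf => hf.modEq v
    simp only [Set.mem_ofPred_eq, hfg v (by simp)]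
  filter_upwards [h1, h2] with f hf hf' using ⟨hf, hf'⟩

/-! ### The Gibbs property -/

/-- The configurations of a domain `D ⊇ Λ` that agree with `f` off `Λ`. -/
def fibre (D Λ : Set (Vertex d)) (f : Vertex d → ℤ) : Set (Vertex d → ℤ) :=
  {g ∈ configs D | ∀ v ∉ Λ, g v = f v}

/-- The finite-volume measure on `Λ` with boundary values taken from a configuration `f` of a larger
domain is the law of a uniform configuration conditioned to agree with `f` off `Λ`. -/
theorem finiteVolume_eq_map_fibre [NeZero d] {D Λ : Set (Vertex d)} (hD : D.Finite) (h : Λ ⊆ D)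
    {f : Vertex d → ℤ} (hf : f ∈ configs D) :
    finiteVolume Λ (restr (boundary Λ) f) =
      (uniformOn (fibre D Λ f)).map (restr (extension Λ)) := by
  have hfin : (fibre D Λ f).Finite := (configs_finite hD).subset fun _ h => h.1
  have hinj : Set.InjOn (restr (extension Λ)) (fibre D Λ f) := by
    intro g hg g' hg' hgg'
    ext v
    by_cases hv : v ∈ Λ
    · exact congrFun hgg' ⟨v, Or.inl hv⟩
    · rw [hg.2 v hv, hg'.2 v hv]
  have himage : restr (extension Λ) '' fibre D Λ f =
      {g | IsHeight g ∧ restrSub (boundary_subset_extension Λ) g = restr (boundary Λ) f} := by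
    ext g
    constructor
    · rintro ⟨g, hg, rfl⟩
      exact ⟨hg.1.1.isHeight_restr _, funext fun v => hg.2 v.1 v.2.1⟩
    · rintro ⟨hg, hb⟩
      refine ⟨glue Λ g f, ⟨⟨isGlobalHeight_glue hg hf.1 hb, fun v hv => ?_⟩,
        fun v hv => glue_of_notMem g f hv⟩, restr_glue hb⟩
      rw [glue_of_notMem g f fun h' => hv (h h'), hf.2 v hv]
  rw [map_uniformOn hfin (measurable_restr _) hinj, himage]
  rfl

/-- The domain Markov property of the finite-volume measures. -/
theorem average_mul_finiteVolume [NeZero d] {D Λ : Set (Vertex d)} (hD : D.Finite) (h : Λ ⊆ D)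
    {A : Set (extension Λ → ℤ)} (hA : MeasurableSet A) {ψ : (Vertex d → ℤ) → ℝ}
    (hψ : DependsOn ψ Λᶜ) :
    average D (fun f => ψ f * (finiteVolume Λ (restr (boundary Λ) f)).real A) =
      average D (fun f => ψ f * (restr (extension Λ) ⁻¹' A).indicator 1 f) := by
  classical
  have hfin := configs_finite hD
  set B := restr (extension Λ) ⁻¹' A
  have hB : MeasurableSet B := measurable_restr _ hA
  rw [average, average]
  congr 1
  rw [finsum_mem_eq_finite_toFinset_sum _ hfin, finsum_mem_eq_finite_toFinset_sum _ hfin,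
    ← Finset.sum_fiberwise_of_maps_to (t := hfin.toFinset.image (restr Λᶜ)) (g := restr Λᶜ)
      (fun f hf => Finset.mem_image_of_mem _ hf),
    ← Finset.sum_fiberwise_of_maps_to (t := hfin.toFinset.image (restr Λᶜ)) (g := restr Λᶜ)
      (fun f hf => Finset.mem_image_of_mem _ hf)]
  refine Finset.sum_congr rfl fun c hc => ?_
  obtain ⟨f₀, hf₀, rfl⟩ := Finset.mem_image.1 hc
  have hf₀' : f₀ ∈ configs D := by simpa using hf₀
  set s := hfin.toFinset.filter fun f => restr Λᶜ f = restr Λᶜ f₀ with hs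
  have hs_mem : ∀ f, f ∈ s ↔ f ∈ configs D ∧ ∀ v ∉ Λ, f v = f₀ v := by
    intro f
    simp only [hs, Finset.mem_filter, Set.Finite.mem_toFinset]
    exact and_congr_right fun _ => ⟨fun h v hv => congrFun h ⟨v, hv⟩, fun h => funext fun v =>
      h v.1 v.2⟩
  have hψs : ∀ f ∈ s, ψ f = ψ f₀ := fun f hf => hψ fun v hv => ((hs_mem f).1 hf).2 v hv
  have hq : ∀ f ∈ s, (finiteVolume Λ (restr (boundary Λ) f)).real A =
      (∑ g ∈ s, B.indicator 1 g) / s.card := by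
    intro f hf
    have hf' := (hs_mem f).1 hf
    have hfib : fibre D Λ f = s := by
      ext g
      rw [Finset.mem_coe, hs_mem]
      exact and_congr_right fun _ => forall₂_congr fun v hv => by rw [hf'.2 v hv]
    rw [finiteVolume_eq_map_fibre hD h hf'.1, map_measureReal_apply (measurable_restr _) hA,
      ← integral_indicator_one hB, hfib, integral_uniformOn s.finite_toSet,
      finsum_mem_coe_finset, Set.ncard_coe_finset]
  have hcard : (s.card : ℝ) ≠ 0 := by
    have : f₀ ∈ s := (hs_mem f₀).2 ⟨hf₀', fun _ _ => rfl⟩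
    exact_mod_cast (Finset.card_pos.2 ⟨f₀, this⟩).ne'
  have hleft : ∀ f ∈ s, ψ f * (finiteVolume Λ (restr (boundary Λ) f)).real A =
      ψ f₀ * ((∑ g ∈ s, B.indicator 1 g) / s.card) := fun f hf => by rw [hψs f hf, hq f hf]
  have hright : ∀ f ∈ s, ψ f * B.indicator 1 f = ψ f₀ * B.indicator 1 f :=
    fun f hf => by rw [hψs f hf]
  rw [Finset.sum_congr rfl hleft, Finset.sum_congr rfl hright, ← Finset.mul_sum, Finset.sum_const,
    nsmul_eq_mul]
  field_simp
  rw [Finset.mul_sum]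

theorem boundary_finite {Λ : Set (Vertex d)} (hΛ : Λ.Finite) : (boundary Λ).Finite := by
  obtain ⟨n, hn⟩ := exists_subset_ball hΛ
  refine (ball_finite (2 * n + 2)).subset ?_
  rintro v ⟨_, w, hw, ha⟩
  have h1 : l1norm w ≤ 2 * n + 1 := hn hw
  have h2 := l1norm_sub_le v w 0
  have h3 := ha.symm
  rw [Adj] at h3
  simp only [sub_zero] at h2
  exact show l1norm v ≤ _ by omega

theorem finiteVolume_real_le_one (Λ : Set (Vertex d)) (τ : boundary Λ → ℤ)
    (A : Set (extension Λ → ℤ)) : (finiteVolume Λ τ).real A ≤ 1 := by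
  have : IsZeroOrProbabilityMeasure (finiteVolume Λ τ) :=
    inferInstanceAs (IsZeroOrProbabilityMeasure (uniformOn _))
  exact measureReal_le_one

theorem dependsOn_finiteVolume {Λ : Set (Vertex d)} (A : Set (extension Λ → ℤ)) :
    DependsOn (fun f : Vertex d → ℤ => (finiteVolume Λ (restr (boundary Λ) f)).real A)
      (boundary Λ) := by
  intro f g hfg
  have : restr (boundary Λ) f = restr (boundary Λ) g := funext fun v => hfg v.1 v.2
  simp only [this]

theorem dependsOn_preimage_restr {S : Set (Vertex d)} (A : Set (S → ℤ)) :
    DependsOn (fun f => f ∈ restr S ⁻¹' A) S := by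
  intro f g hfg
  have : restr S f = restr S g := funext fun v => hfg v.1 v.2
  simp only [Set.mem_preimage, this]

/-- A bounded function of finitely many coordinates that integrates like the indicator of `B`
against the indicator of `P` in large balls does so under the limit. -/
theorem setIntegral_eq_of_average_eq [NeZero d] {μ : ProbabilityMeasure (Vertex d → ℤ)}
    (h : Tendsto (ballLaw d) atTop (𝓝 μ)) {q : (Vertex d → ℤ) → ℝ} {B P : Set (Vertex d → ℤ)}
    {T : Set (Vertex d)} (hT : T.Finite) (hB : DependsOn (fun f => f ∈ B) T)
    (hP : DependsOn (fun f => f ∈ P) T) (hq : DependsOn q T) (hq0 : ∀ f, 0 ≤ q f)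
    (hq1 : ∀ f, q f ≤ 1)
    (heq : ∀ᶠ n in atTop, average (ball d (2 * n + 1)) (fun f => P.indicator 1 f * q f) =
      average (ball d (2 * n + 1)) (fun f => P.indicator 1 f * B.indicator 1 f)) :
    ∫ f in P, q f ∂(μ : Measure (Vertex d → ℤ)) = (μ : Measure (Vertex d → ℤ)).real (B ∩ P) := by
  have hBm := measurableSet_of_dependsOn hT hB
  have hPm := measurableSet_of_dependsOn hT hP
  have h1 := tendsto_integral_of_dependsOn h (φ := fun f => P.indicator 1 f * q f) hT
    (fun f g hfg => by simp only [dependsOn_indicator hP hfg, hq hfg])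
    (C := 1) (fun f => by
      rw [abs_mul, abs_of_nonneg (hq0 f)]
      exact mul_le_one₀ (abs_indicator_one_le _ _) (hq0 f) (hq1 f))
  have h2 := tendsto_integral_of_dependsOn h (φ := fun f => P.indicator 1 f * B.indicator 1 f) hT
    (fun f g hfg => by simp only [dependsOn_indicator hP hfg, dependsOn_indicator hB hfg])
    (C := 1) (fun f => by
      rw [abs_mul]
      exact mul_le_one₀ (abs_indicator_one_le _ _) (abs_nonneg _) (abs_indicator_one_le _ _))
  simp only [integral_ballLaw] at h1 h2
  have h3 := tendsto_nhds_unique (h1.congr' heq) h2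
  have h4 : ∀ f, P.indicator 1 f * q f = P.indicator q f := fun f => by
    by_cases hf : f ∈ P <;> simp [hf]
  have h5 : ∀ f, P.indicator (1 : (Vertex d → ℤ) → ℝ) f * B.indicator (1 : (Vertex d → ℤ) → ℝ) f =
      (B ∩ P).indicator (1 : (Vertex d → ℤ) → ℝ) f := fun f => by
    rw [Set.inter_comm, Set.inter_indicator_one]
    rfl
  simp only [h4, h5] at h3
  rwa [integral_indicator hPm, integral_indicator_one (hBm.inter hPm)] at h3

/-- The defining identity of the Gibbs property, for cylinder events off `Λ`: it passes to the limit
from the domain Markov property because both sides only involve finitely many vertices. -/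
theorem setIntegral_finiteVolume_of_tendsto [NeZero d] {μ : ProbabilityMeasure (Vertex d → ℤ)}
    (h : Tendsto (ballLaw d) atTop (𝓝 μ)) {Λ : Set (Vertex d)} (hΛ : Λ.Finite)
    {A : Set (extension Λ → ℤ)} (hA : MeasurableSet A)
    (I : Finset (Λᶜ : Set (Vertex d))) (a : (Λᶜ : Set (Vertex d)) → ℤ) :
    ∫ f in restr Λᶜ ⁻¹' pinned I a, (finiteVolume Λ (restr (boundary Λ) f)).real A
        ∂(μ : Measure (Vertex d → ℤ)) =
      (μ : Measure (Vertex d → ℤ)).real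
        (restr (extension Λ) ⁻¹' A ∩ restr Λᶜ ⁻¹' pinned I a) := by
  set J : Set (Vertex d) := Subtype.val '' (I : Set (Λᶜ : Set (Vertex d)))
  have hPdep : DependsOn (fun f => f ∈ restr Λᶜ ⁻¹' pinned I a) J := fun f g hfg =>
    dependsOn_pinned I a fun v hv => hfg v.1 ⟨v, hv, rfl⟩
  have hψ : DependsOn ((restr Λᶜ ⁻¹' pinned I a).indicator (1 : (Vertex d → ℤ) → ℝ)) Λᶜ :=
    fun f g hfg => dependsOn_indicator hPdep fun v hv => by
      obtain ⟨w, _, rfl⟩ := hv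
      exact hfg _ w.2
  obtain ⟨N, hN⟩ := exists_subset_ball hΛ
  refine setIntegral_eq_of_average_eq h (T := J ∪ extension Λ)
    ((I.finite_toSet.image _).union (hΛ.union (boundary_finite hΛ)))
    (fun f g hfg => dependsOn_preimage_restr A fun v hv => hfg v (Or.inr hv))
    (fun f g hfg => hPdep fun v hv => hfg v (Or.inl hv))
    (fun f g hfg => dependsOn_finiteVolume A fun v hv => hfg v (Or.inr (Or.inr hv)))
    (fun _ => measureReal_nonneg) (fun _ => finiteVolume_real_le_one _ _ _) ?_
  filter_upwards [eventually_ge_atTop N] with n hn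
  exact average_mul_finiteVolume (ball_finite _) (hN.trans (ball_subset_ball (by omega))) hA hψ

/-- A function of the values off `Λ` with the right integrals over cylinder events is a version of
the conditional probability. -/
theorem condExp_ae_eq_of_pinned {ν : Measure (Vertex d → ℤ)} [IsFiniteMeasure ν]
    {S : Set (Vertex d)} {B : Set (Vertex d → ℤ)} (hB : MeasurableSet B) {q' : (S → ℤ) → ℝ}
    (hq'meas : Measurable q') (hq0 : ∀ c, 0 ≤ q' c) (hq1 : ∀ c, q' c ≤ 1)
    (hcyl : ∀ (I : Finset S) (a : S → ℤ),
      ∫ f in restr S ⁻¹' pinned I a, q' (restr S f) ∂ν = ν.real (B ∩ restr S ⁻¹' pinned I a)) :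
    ν⟦B | MeasurableSpace.comap (restr S) MeasurableSpace.pi⟧ =ᵐ[ν] fun f => q' (restr S f) := by
  have hr : Measurable (restr S) := measurable_restr S
  have hqint : Integrable (fun f => q' (restr S f)) ν :=
    Integrable.of_bound (hq'meas.comp hr).aestronglyMeasurable 1
      (Eventually.of_forall fun f => by
        rw [Real.norm_eq_abs, abs_of_nonneg (hq0 _)]; exact hq1 _)
  -- both sides of `hcyl` are finite measures in the event
  have hmeas : (ν.withDensity fun f => ENNReal.ofReal (q' (restr S f))).map (restr S) =
      (ν.restrict B).map (restr S) := by
    have : IsFiniteMeasure (ν.withDensity fun f => ENNReal.ofReal (q' (restr S f))) :=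
      isFiniteMeasure_withDensity_ofReal hqint.2
    refine ext_of_pinned fun I a => ?_
    have hP := hr (measurableSet_pinned I a)
    rw [Measure.map_apply hr (measurableSet_pinned I a),
      Measure.map_apply hr (measurableSet_pinned I a), withDensity_apply _ hP,
      Measure.restrict_apply hP, ← ofReal_integral_eq_lintegral_ofReal hqint.integrableOn
        (Eventually.of_forall fun _ => hq0 _), hcyl, Set.inter_comm, ofReal_measureReal]
  refine (ae_eq_condExp_of_forall_setIntegral_eq hr.comap_le ?_
    (fun _ _ _ => hqint.integrableOn) ?_ ?_).symm
  · exact (integrable_const (1 : ℝ)).indicator hB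
  · rintro _ ⟨C, hC, rfl⟩ -
    have h1 := congrArg (fun ρ : Measure (S → ℤ) => ρ C) hmeas
    rw [Measure.map_apply hr hC, Measure.map_apply hr hC, withDensity_apply _ (hr hC),
      Measure.restrict_apply (hr hC), ← ofReal_integral_eq_lintegral_ofReal hqint.integrableOn
        (Eventually.of_forall fun _ => hq0 _), ← ofReal_measureReal,
      ENNReal.ofReal_eq_ofReal_iff (integral_nonneg fun _ => hq0 _) measureReal_nonneg] at h1
    rw [h1, setIntegral_indicator hB]
    simp
  · have : Measurable[MeasurableSpace.comap (restr S) MeasurableSpace.pi]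
        fun f => q' (restr S f) := hq'meas.comp (comap_measurable (restr S))
    exact this.stronglyMeasurable.aestronglyMeasurable

theorem isGibbs_of_tendsto [NeZero d] {μ : ProbabilityMeasure (Vertex d → ℤ)}
    (h : Tendsto (ballLaw d) atTop (𝓝 μ)) : IsGibbs (μ : Measure (Vertex d → ℤ)) := by
  refine ⟨inferInstance, ?_, fun Λ _ hΛ A hA => ?_⟩
  · filter_upwards [ae_isGlobalHeight_of_tendsto h] with f hf
      using isHeight_restr_univ_iff.2 hf
  have hsub : boundary Λ ⊆ Λᶜ := fun v hv => hv.1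
  let q' : ((Λᶜ : Set (Vertex d)) → ℤ) → ℝ := fun c => (finiteVolume Λ (restrSub hsub c)).real A
  have hdep : DependsOn q' (Subtype.val ⁻¹' boundary Λ) := by
    intro c c' hcc'
    have : restrSub hsub c = restrSub hsub c' := funext fun v => hcc' ⟨v.1, hsub v.2⟩ v.2
    simp only [q', this]
  have hmeas : Measurable q' := (continuous_of_dependsOn
    ((boundary_finite hΛ).preimage Subtype.val_injective.injOn) hdep).measurable
  exact condExp_ae_eq_of_pinned (measurable_restr _ hA) hmeas (fun _ => measureReal_nonneg)
    (fun _ => finiteVolume_real_le_one _ _ _) (setIntegral_finiteVolume_of_tendsto h hΛ hA)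

/-! ### The dichotomy -/

theorem supTail_antitone : Antitone (supTail d) := by
  intro M N hMN
  refine iSup_mono fun n => measure_mono fun f hf => ?_
  exact lt_of_le_of_lt (Int.ofNat_le.2 hMN) hf

theorem tendsto_measure_lt_abs (ν : Measure (Vertex d → ℤ)) [IsFiniteMeasure ν] :
    Tendsto (fun M : ℕ => ν {f | (M : ℤ) < |f 0|}) atTop (𝓝 0) := by
  have hmeas : ∀ M : ℕ, MeasurableSet {f : Vertex d → ℤ | (M : ℤ) < |f 0|} := fun M =>
    measurableSet_lt measurable_const (measurable_pi_apply _).abs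
  have h := tendsto_measure_iInter_atTop (μ := ν) (fun M => (hmeas M).nullMeasurableSet)
    (fun M N hMN f hf => lt_of_le_of_lt (Int.ofNat_le.2 hMN) hf) ⟨0, measure_ne_top ν _⟩
  have hempty : ⋂ M : ℕ, {f : Vertex d → ℤ | (M : ℤ) < |f 0|} = ∅ := by
    refine Set.eq_empty_of_forall_notMem fun f hf => ?_
    have : ((f 0).natAbs : ℤ) < |f 0| := Set.mem_iInter.1 hf (f 0).natAbs
    rw [Int.natCast_natAbs] at this
    exact lt_irrefl _ this
  rwa [hempty, measure_empty] at h

/-- Convergence in distribution forces tightness of the heights at the origin. -/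
theorem tendsto_supTail_of_convergesInDistribution [NeZero d] {μ : Measure (Vertex d → ℤ)}
    [IsProbabilityMeasure μ]
    (h : ConvergesInDistribution (fun n => ball d (2 * n + 1)) (fun _ => 0) μ) :
    Tendsto (supTail d) atTop (𝓝 0) := by
  classical
  rw [ENNReal.tendsto_nhds_zero]
  intro ε hε
  obtain ⟨δ, hδ0, hδε⟩ := ENNReal.lt_iff_exists_nnreal_btwn.1 hε
  have hδ : (0 : ℝ) < δ / 2 := by
    have : 0 < δ := by exact_mod_cast hδ0
    positivity
  obtain ⟨M, hM⟩ := ((tendsto_order.1 (tendsto_measure_lt_abs μ)).2 (ENNReal.ofReal (δ / 2))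
    (ENNReal.ofReal_pos.2 hδ)).exists
  let S : Set (Vertex d) := {0}
  let E : Set (S → ℤ) := {g | (M : ℤ) < |g ⟨0, rfl⟩|}
  have hE : MeasurableSet E := measurableSet_lt measurable_const (measurable_pi_apply _).abs
  let φ : (S → ℤ) →ᵇ ℝ := BoundedContinuousFunction.ofNormedAddCommGroup
    (E.indicator (1 : (S → ℤ) → ℝ)) continuous_of_discreteTopology 1 (abs_indicator_one_le E)
  have hint : ∀ ν : Measure (S → ℤ), ∫ g, φ g ∂ν = ν.real E := fun ν => integral_indicator_one hE
  obtain ⟨N, hN⟩ := eventually_atTop.1 (h S (Set.finite_singleton 0) φ (δ / 2) hδ)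
  have hlarge : ∀ n ≥ N, (ballLaw d n : Measure (Vertex d → ℤ)) {f | (M : ℤ) < |f 0|} ≤ ε := by
    intro n hn
    obtain ⟨hsub, hlt⟩ := hN n hn
    have hr : Measurable (restrSub hsub : (_ → ℤ) → (S → ℤ)) :=
      measurable_pi_lambda _ fun v => measurable_pi_apply _
    rw [hint, hint, finiteVolume_zero_eq_map (isEvenDomain_ball n),
      Measure.map_map hr (measurable_restr _),
      map_measureReal_apply (hr.comp (measurable_restr _)) hE,
      map_measureReal_apply (measurable_restr _) hE] at hlt
    have h1 : (ballLaw d n : Measure (Vertex d → ℤ)).real {f | (M : ℤ) < |f 0|} -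
        μ.real {f | (M : ℤ) < |f 0|} < δ / 2 := (abs_lt.1 hlt).2
    have h2 : μ.real {f | (M : ℤ) < |f 0|} < δ / 2 := by
      rw [measureReal_def]
      exact ENNReal.toReal_lt_of_lt_ofReal hM
    refine le_trans ?_ hδε.le
    rw [← ofReal_measureReal, ← ENNReal.ofReal_coe_nnreal]
    exact ENNReal.ofReal_le_ofReal (by linarith)
  have hsmall : ∀ᶠ M' : ℕ in atTop, ∀ n ∈ Finset.range N,
      (ballLaw d n : Measure (Vertex d → ℤ)) {f | (M' : ℤ) < |f 0|} ≤ ε := by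
    refine (Finset.eventually_all _).2 fun n _ => ?_
    exact ((tendsto_order.1 (tendsto_measure_lt_abs _)).2 ε hε).mono fun _ h => h.le
  filter_upwards [hsmall, eventually_ge_atTop M] with M' hM' hMM'
  rw [supTail_eq]
  refine iSup_le fun n => ?_
  by_cases hn : n < N
  · exact hM' n (Finset.mem_range.2 hn)
  · refine (measure_mono fun f hf => ?_).trans (hlarge n (not_lt.1 hn))
    exact lt_of_le_of_lt (Int.ofNat_le.2 hMM') hf

end HomHeight


theorem theorem1p1 (d : ℕ) (hd : 1 ≤ d) :
    (HomHeight.NotTightAtZero d ∨ HomHeight.ConvergesToInvariantGibbs d) ∧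
      ¬ (HomHeight.NotTightAtZero d ∧ HomHeight.ConvergesToInvariantGibbs d) := by
  have : NeZero d := ⟨by omega⟩
  have hlim := tendsto_atTop_iInf (HomHeight.supTail_antitone (d := d))
  constructor
  · by_cases h0 : ⨅ M, HomHeight.supTail d M = 0
    · rw [h0] at hlim
      obtain ⟨μ, hμ⟩ := HomHeight.exists_tendsto_ballLaw hlim
      exact Or.inr ⟨μ, HomHeight.isGibbs_of_tendsto hμ,
        HomHeight.isTranslationInvariant_of_tendsto hμ,
        HomHeight.convergesInDistribution_of_tendsto hμ⟩
    · exact Or.inl ⟨_, pos_iff_ne_zero.2 h0, hlim⟩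
  · rintro ⟨⟨c, hc, hc'⟩, μ, hμ, -, hconv⟩
    have := hμ.1
    exact hc.ne (tendsto_nhds_unique
      (HomHeight.tendsto_supTail_of_convergesInDistribution hconv) hc')
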